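/- All graphs are finite and simple. A graph $F$ is a minor of a graph $G$ if $F$ can be obtained from $G$ by deleting vertices, deleting edges and contracting edges. The spectral radius of a graph is that of its adjacency matrix, and $SPEX(n,\{F\}_{minor})$ denotes the set of $n$-vertex graphs of maximal spectral radius among all $n$-vertex graphs that do not have $F$ as a minor. The book $B_{s,t}$ is the join of a clique on $s$ vertices and an independent set on $t$ vertices, and $B^k_{s,t}$ (for $2k\le t$) is obtained from $B_{s,t}$ by adding $k$ pairwise disjoint edges inside its independent set. Let $r\ge 1$, let $H$ be a subgraph of the complete graph $K_r$ (with at least one vertex) with clique number $\omega(H)$, and let $K_r-E(H)$ be the graph obtained from $K_r$ by deleting the edges of $H$. Put $\gamma=r-\omega(H)-1$ and assume $\gamma\ge 1$. Then there is an $N$, depending only on $r$ and $H$, such that the following hold for all $n\ge N$. (i) Every graph in $SPEX(n,\{K_r-E(H)\}_{minor})$ contains the book $B_{\gamma,n-\gamma}$ as a spanning subgraph. (ii) If $\omega(H)=2$ and the edges of $H$ are pairwise disjoint (that is, $H$ without its isolated vertices is a disjoint union of copies of $K_2$; $H$ need not cover all the vertices of $K_r$), then, up to isomorphism, $B^{\lfloor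 (n-r+3)/2\rfloor}_{r-3,\,n-r+3}$ is the unique graph in $SPEX(n,\{K_r-E(H)\}_{minor})$. (iii) If $\omega(H)=2$ and two distinct edges of $H$ share a vertex, then, up to isomorphism, $B_{r-3,\,n-r+3}$ is the unique graph in $SPEX(n,\{K_r-E(H)\}_{minor})$. -/

import Mathlib

namespace MinorSpectral

open SimpleGraph

/-- `H` is a minor of `G`: there is a model of `H` in `G`, i.e. a family of pairwise disjoint vertex
sets of `G`, one for each vertex of `H`, each inducing a connected (hence nonempty) subgraph, such
that the sets of any two adjacent vertices of `H` are joined by an edge of `G`. -/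
def IsMinor {W V : Type*} (H : SimpleGraph W) (G : SimpleGraph V) : Prop :=
  ∃ B : W → Set V,
    (∀ w, (G.induce (B w)).Connected) ∧
    (∀ w w', w ≠ w' → Disjoint (B w) (B w')) ∧
    (∀ w w', H.Adj w w' → ∃ x ∈ B w, ∃ y ∈ B w', G.Adj x y)

open Classical in
/-- The spectral radius of a finite graph: the largest modulus of an eigenvalue of its adjacency
matrix (which is real symmetric, so all its eigenvalues are real). -/
noncomputable def graphSpectralRadius {V : Type*} [Fintype V] (G : SimpleGraph V) : ENNReal :=
  spectralRadius ℝ (G.adjMatrix ℝ)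

/-- `SPEX(n, {F}_minor)`: the graphs on `n` vertices that have no `F` minor and whose spectral radius
is the largest among all such graphs. -/
def SPEX {W : Type*} (n : ℕ) (F : SimpleGraph W) : Set (SimpleGraph (Fin n)) :=
  {G | ¬ IsMinor F G ∧
    ∀ G' : SimpleGraph (Fin n), ¬ IsMinor F G' → graphSpectralRadius G' ≤ graphSpectralRadius G}

/-- The join of two graphs: their disjoint union together with all edges between them. -/
def join {V W : Type*} (G : SimpleGraph V) (H : SimpleGraph W) : SimpleGraph (V ⊕ W) :=
  (G ⊕g H) ⊔ completeBipartiteGraph V W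

/-- The book `B_{s,t}`: the join of an `s`-clique with `t` independent vertices. -/
def book (s t : ℕ) : SimpleGraph (Fin s ⊕ Fin t) :=
  join (⊤ : SimpleGraph (Fin s)) (⊥ : SimpleGraph (Fin t))

/-- The graph on `t` vertices whose edges are the `k` pairwise disjoint pairs
`{0, 1}, {2, 3}, …, {2k - 2, 2k - 1}` (intended for `2 * k ≤ t`). -/
def isolatedEdges (t k : ℕ) : SimpleGraph (Fin t) where
  Adj i j := i ≠ j ∧ (i : ℕ) / 2 = (j : ℕ) / 2 ∧ (i : ℕ) / 2 < k
  symm.symm _ _ h := ⟨h.1.symm, h.2.1.symm, h.2.1 ▸ h.2.2⟩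
  loopless.irrefl _ h := h.1 rfl

/-- `B^k_{s,t}`: the book `B_{s,t}` with `k` isolated edges added within its independent set. -/
def bookWithEdges (k s t : ℕ) : SimpleGraph (Fin s ⊕ Fin t) :=
  join (⊤ : SimpleGraph (Fin s)) (isolatedEdges t k)

/-- `A` is (up to isomorphism) a spanning subgraph of `G`. -/
def ContainsSpanning {W V : Type*} (G : SimpleGraph V) (A : SimpleGraph W) : Prop :=
  ∃ f : A →g G, Function.Bijective f

/-- `K_r - E(H)` for a subgraph `H` of `K_r`. -/
def completeMinus {r : ℕ} (H : SimpleGraph (Fin r)) : SimpleGraph (Fin r) :=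
  (completeGraph (Fin r)).deleteEdges H.edgeSet

/-- The edges of `H` are pairwise disjoint; equivalently `H`, apart from isolated vertices, is a
disjoint union of copies of `K_2`. -/
def EdgesDisjoint {V : Type*} (H : SimpleGraph V) : Prop :=
  ∀ u v w, H.Adj u v → H.Adj u w → v = w

end MinorSpectral

/-! Write F for `completeMinus H`, γ = r - ω(H) - 1, and let x be a Perron vector, scaled to maximum
1, of an extremal graph G with spectral radius ρ. Three facts about F-minors drive the proof.
F-minor-free graphs are sparse (`exists_adjPairs_le`). Any γ + 1 vertices of such a graph have fewer
than r common neighbours (`card_common_neighbors_lt`). The book on γ dominating vertices has no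
F-minor (`not_isMinor_of_independent`), so ρ² ≥ γ(n - γ).

Expanding ρ² x_v over walks of length two, sparsity leaves only boundedly many entries that are not
small, and all but boundedly many vertices see at most γ of them. At a vertex of entry 1 the lower
bound on ρ² is then nearly tight. Hence almost every vertex is adjacent to the same γ vertices,
whose entries are close to 1, and all other entries are small (`SparsePerron.exists_core`). Let L be
this set.

To make L dominating, reattach some vertices to exactly L. This creates no F-minor as long as r of
them were already complete to L (`IsMinor.of_pendant`). Losing edges to vertices of small entry
costs almost nothing, while gaining an edge to L is worth a constant. A missing edge at L would
therefore contradict extremality (`SparsePerron.dominating`), which gives (i).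

When ω(H) = 2, three vertices outside L together with L can carry F directly (`isMinor_of_triple`).
This forces the graph outside L to be a matching or to be empty, so G is a spanning subgraph of the
claimed graph. Since a dominating vertex makes x positive, adding edges strictly increases ρ
(`graphSpectralRadius_lt`), so the two graphs are isomorphic. -/

namespace MinorSpectral

open SimpleGraph

/-! ### Minor models: building, transferring and excluding them -/

section Minors
open scoped Classical

variable {V W : Type*}

lemma connected_of_reachable {G : SimpleGraph V} {B : Set V} {c : V} (hc : c ∈ B)
    (h : ∀ u (hu : u ∈ B), (G.induce B).Reachable ⟨u, hu⟩ ⟨c, hc⟩) : (G.induce B).Connected := by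
  have : Nonempty B := ⟨⟨c, hc⟩⟩
  exact ⟨fun u v => (h u u.2).trans (h v v.2).symm⟩

lemma connected_singleton (G : SimpleGraph V) (c : V) : (G.induce {c}).Connected := by
  refine connected_of_reachable (Set.mem_singleton c) fun u hu => ?_
  obtain rfl := Set.mem_singleton_iff.1 hu
  exact Reachable.refl _

lemma connected_insert {G : SimpleGraph V} {B : Set V} (hB : (G.induce B).Connected) {c d : V}
    (hd : d ∈ B) (h : G.Adj d c) : (G.induce (insert c B)).Connected := by
  have h1 : (G.induce (B ∪ {d, c})).Connected :=
    induce_union_connected hB.preconnected (induce_pair_connected_of_adj h).preconnected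
      ⟨d, hd, by simp⟩
  have h2 : B ∪ {d, c} = insert c B := by
    ext z
    simp only [Set.mem_union, Set.mem_insert_iff, Set.mem_singleton_iff]
    constructor
    · rintro (h | rfl | h) <;> tauto
    · tauto
  rwa [h2] at h1

lemma exists_adj_of_connected {G : SimpleGraph V} {B : Set V} (hB : (G.induce B).Connected)
    {u v : V} (hu : u ∈ B) (hv : v ∈ B) (h : u ≠ v) : ∃ z ∈ B, G.Adj u z := by
  obtain ⟨p⟩ := hB.preconnected ⟨u, hu⟩ ⟨v, hv⟩
  cases p with
  | nil => exact absurd rfl h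
  | @cons _ z _ hz _ => exact ⟨z, z.2, hz⟩

lemma IsMinor.of_injective {F : SimpleGraph W} {G : SimpleGraph V} (f : W → V)
    (hf : Function.Injective f) (h : ∀ i j, F.Adj i j → G.Adj (f i) (f j)) : IsMinor F G :=
  ⟨fun i => {f i}, fun i => connected_singleton G (f i),
    fun i j hij => by simpa using fun h => hij (hf h),
    fun i j hij => ⟨f i, rfl, f j, rfl, h i j hij⟩⟩

lemma IsMinor.of_bijective {V' : Type*} {F : SimpleGraph W} {G : SimpleGraph V}
    {G' : SimpleGraph V'} (e : V ≃ V') (he : ∀ u v, G.Adj u v → G'.Adj (e u) (e v))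
    (h : IsMinor F G) : IsMinor F G' := by
  obtain ⟨B, h1, h2, h3⟩ := h
  refine ⟨fun i => e '' B i, fun i => ?_, fun i j hij => ?_, fun i j hij => ?_⟩
  · obtain ⟨c⟩ := (h1 i).nonempty
    let φ : G.induce (B i) →g G'.induce (e '' B i) :=
      ⟨fun v => ⟨e v, Set.mem_image_of_mem e v.2⟩, fun {a b} hab => he a b hab⟩
    refine connected_of_reachable (Set.mem_image_of_mem e c.2) ?_
    rintro _ ⟨u, hu, rfl⟩
    exact ((h1 i).preconnected ⟨u, hu⟩ c).map φ
  · exact (Set.disjoint_image_iff e.injective).2 (h2 i j hij)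
  · obtain ⟨x, hx, y, hy, hxy⟩ := h3 i j hij
    exact ⟨e x, Set.mem_image_of_mem e hx, e y, Set.mem_image_of_mem e hy, he x y hxy⟩

/-- If `G'` arises from `G` by making the vertices of `J` adjacent to vertices of `L` only and
adding edges within `L`, and if `J` contains enough vertices that are complete to `L` in `G`, then
every minor of `G'` is a minor of `G`. -/
lemma IsMinor.of_pendant {F : SimpleGraph W} {G G' : SimpleGraph V} {L J : Set V}
    (hLJ : Disjoint L J) (c : W → V) (hc : Function.Injective c) (hcJ : ∀ i, c i ∈ J)
    (hcL : ∀ i, ∀ l ∈ L, G.Adj l (c i)) (hJ : ∀ u ∈ J, ∀ v, G'.Adj u v → v ∈ L)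
    (hG : ∀ u v, u ∉ J → v ∉ J → ¬ (u ∈ L ∧ v ∈ L) → G'.Adj u v → G.Adj u v)
    (h : IsMinor F G') : IsMinor F G := by
  obtain ⟨B, h1, h2, h3⟩ := h
  have hnot : ∀ {x}, x ∈ L → x ∉ J := fun hx hx' => Set.disjoint_left.1 hLJ hx hx'
  have hJs : ∀ i, (¬ ∃ l ∈ B i, l ∈ L) → (∃ u ∈ B i, u ∈ J) → ∀ x ∈ B i, x ∈ J := by
    rintro i hi ⟨u, hu, huJ⟩ x hx
    by_cases hux : u = x
    · exact hux ▸ huJ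
    · obtain ⟨z, hz, huz⟩ := exists_adj_of_connected (h1 i) hu hx hux
      exact absurd ⟨z, hz, hJ u huJ z huz⟩ hi
  -- A branch set meeting L trades its vertices of J for the private hub `c i`. One that avoids L
  -- but meets J lies inside J and becomes `{c i}`. All others stay as they are.
  let B' : W → Set V := fun i =>
    if ∃ l ∈ B i, l ∈ L then insert (c i) (B i \ J)
    else if ∃ u ∈ B i, u ∈ J then {c i} else B i
  have hB1 : ∀ i, (∃ l ∈ B i, l ∈ L) → B' i = insert (c i) (B i \ J) := fun i hi => if_pos hi
  have hB2 : ∀ i, (¬ ∃ l ∈ B i, l ∈ L) → (∃ u ∈ B i, u ∈ J) → B' i = {c i} := fun i hi hi' => by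
    simp only [B', if_neg hi, if_pos hi']
  have hB3 : ∀ i, (¬ ∃ l ∈ B i, l ∈ L) → (¬ ∃ u ∈ B i, u ∈ J) → B' i = B i := fun i hi hi' => by
    simp only [B', if_neg hi, if_neg hi']
  have hsub : ∀ i, ∀ x ∈ B' i, x = c i ∨ (x ∈ B i ∧ x ∉ J) := by
    intro i x hx
    by_cases hi : ∃ l ∈ B i, l ∈ L
    · rw [hB1 i hi] at hx
      exact hx
    · by_cases hi' : ∃ u ∈ B i, u ∈ J
      · rw [hB2 i hi hi'] at hx
        exact Or.inl hx
      · rw [hB3 i hi hi'] at hx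
        exact Or.inr ⟨hx, fun h => hi' ⟨x, hx, h⟩⟩
  refine ⟨B', fun i => ?_, fun i j hij => ?_, fun i j hij => ?_⟩
  · by_cases hi : ∃ l ∈ B i, l ∈ L
    · rw [hB1 i hi]
      have hcm : c i ∈ insert (c i) (B i \ J) := Set.mem_insert _ _
      -- Follow the walk until it first meets L, then jump to the hub. Before that point it cannot
      -- enter J, whose neighbours all lie in L, so edges of `G'` inside L are never used.
      have key : ∀ a b : B i, (G'.induce (B i)).Walk a b → b.1 ∈ L → ∀ ha : a.1 ∉ J,
          (G.induce (insert (c i) (B i \ J))).Reachable ⟨a.1, Or.inr ⟨a.2, ha⟩⟩ ⟨c i, hcm⟩ := by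
        intro a b p hb
        induction p with
        | nil =>
          intro ha
          exact Adj.reachable (hcL i _ hb)
        | @cons a z b haz _ ih =>
          intro ha
          by_cases haL : a.1 ∈ L
          · exact Adj.reachable (hcL i _ haL)
          · have hz : z.1 ∉ J := fun hz => haL (hJ _ hz _ haz.symm)
            have haz' : (G.induce (insert (c i) (B i \ J))).Adj ⟨a.1, Or.inr ⟨a.2, ha⟩⟩
              ⟨z.1, Or.inr ⟨z.2, hz⟩⟩ := hG a.1 z.1 ha hz (fun h => haL h.1) haz
            exact haz'.reachable.trans (ih hb hz)
      obtain ⟨l, hl, hlL⟩ := hi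
      refine connected_of_reachable hcm fun u hu => ?_
      rcases hu with rfl | hu
      · exact Reachable.refl _
      · obtain ⟨p⟩ := (h1 i).preconnected ⟨u, hu.1⟩ ⟨l, hl⟩
        exact key _ _ p hlL hu.2
    · by_cases hi' : ∃ u ∈ B i, u ∈ J
      · rw [hB2 i hi hi']
        exact connected_singleton G _
      · rw [hB3 i hi hi']
        obtain ⟨v⟩ := (h1 i).nonempty
        have key : ∀ a b : B i, (G'.induce (B i)).Adj a b → (G.induce (B i)).Adj a b :=
          fun a b hab => hG _ _ (fun h => hi' ⟨a, a.2, h⟩) (fun h => hi' ⟨b, b.2, h⟩)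
            (fun h => hi ⟨a, a.2, h.1⟩) hab
        exact (h1 i).mono fun a b hab => key a b hab
  · rw [Set.disjoint_left]
    intro x hx hx'
    rcases hsub i x hx with hx1 | hx1 <;> rcases hsub j x hx' with hx2 | hx2
    · exact hij (hc (hx1.symm.trans hx2))
    · exact hx2.2 (hx1 ▸ hcJ i)
    · exact hx1.2 (hx2 ▸ hcJ j)
    · exact Set.disjoint_left.1 (h2 i j hij) hx1.1 hx2.1
  · have key : ∀ i j, (∃ x ∈ B i, ∃ y ∈ B j, G'.Adj x y) → (∃ l ∈ B i, l ∈ L) →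
        ∃ x ∈ B' i, ∃ y ∈ B' j, G.Adj x y := by
      rintro i j ⟨x, hx, y, hy, hxy⟩ ⟨l, hl, hlL⟩
      rw [hB1 i ⟨l, hl, hlL⟩]
      by_cases hj : ∃ l ∈ B j, l ∈ L
      · rw [hB1 j hj]
        exact ⟨l, Or.inr ⟨hl, hnot hlL⟩, c j, Or.inl rfl, hcL j l hlL⟩
      · by_cases hj' : ∃ u ∈ B j, u ∈ J
        · rw [hB2 j hj hj']
          exact ⟨l, Or.inr ⟨hl, hnot hlL⟩, c j, rfl, hcL j l hlL⟩
        · rw [hB3 j hj hj']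
          have hyL : y ∉ L := fun h => hj ⟨y, hy, h⟩
          have hxJ : x ∉ J := fun h => hyL (hJ x h y hxy)
          exact ⟨x, Or.inr ⟨hx, hxJ⟩, y, hy, hG x y hxJ (fun h => hj' ⟨y, hy, h⟩)
            (fun h => hyL h.2) hxy⟩
    obtain ⟨x, hx, y, hy, hxy⟩ := h3 i j hij
    by_cases hi : ∃ l ∈ B i, l ∈ L
    · exact key i j ⟨x, hx, y, hy, hxy⟩ hi
    by_cases hj : ∃ l ∈ B j, l ∈ L
    · obtain ⟨y', hy', x', hx', h⟩ := key j i ⟨y, hy, x, hx, hxy.symm⟩ hj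
      exact ⟨x', hx', y', hy', h.symm⟩
    have hi' : ¬ ∃ u ∈ B i, u ∈ J := fun h => hj ⟨y, hy, hJ x (hJs i hi h x hx) y hxy⟩
    have hj' : ¬ ∃ u ∈ B j, u ∈ J := fun h => hi ⟨x, hx, hJ y (hJs j hj h y hy) x hxy.symm⟩
    rw [hB3 i hi hi', hB3 j hj hj']
    exact ⟨x, hx, y, hy, hG x y (fun h => hi' ⟨x, hx, h⟩) (fun h => hj' ⟨y, hy, h⟩)
      (fun h => hi ⟨x, hx, h.1⟩) hxy⟩

/-- A graph with an independent set `I` is a minor of every graph that contains an injective image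
`M` of the complement of `I` together with enough common neighbours of `M`. -/
lemma IsMinor.of_common_neighbors {F : SimpleGraph W} {G : SimpleGraph V} {I : Set W}
    (hI : ∀ i ∈ I, ∀ j ∈ I, ¬ F.Adj i j) (m c : W → V) (hm : Set.InjOn m Iᶜ)
    (hc : Function.Injective c) (h : ∀ i ∉ I, ∀ j, G.Adj (m i) (c j)) : IsMinor F G := by
  have hmc : ∀ i ∉ I, ∀ j, m i ≠ c j := fun i hi j => (h i hi j).ne
  have hsub : ∀ i x, x ∈ (if i ∈ I then {c i} else {c i, m i} : Set V) →
      x = c i ∨ (i ∉ I ∧ x = m i) := by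
    intro i x hx
    by_cases hi : i ∈ I
    · rw [if_pos hi] at hx
      exact Or.inl hx
    · rw [if_neg hi] at hx
      rcases hx with hx | hx
      · exact Or.inl hx
      · exact Or.inr ⟨hi, hx⟩
  -- Each `m i` is adjacent to every `c j`, so two branch sets are joined unless both indices lie in
  -- I, where no edge is required.
  refine ⟨fun i => if i ∈ I then {c i} else {c i, m i}, fun i => ?_, fun i j hij => ?_,
    fun i j hij => ?_⟩
  · beta_reduce
    by_cases hi : i ∈ I
    · rw [if_pos hi]
      exact connected_singleton G _
    · rw [if_neg hi]
      exact induce_pair_connected_of_adj (h i hi i).symm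
  · rw [Set.disjoint_left]
    intro x hx hx'
    rcases hsub i x hx with hx1 | ⟨hi, hx1⟩ <;> rcases hsub j x hx' with hx2 | ⟨hj, hx2⟩
    · exact hij (hc (hx1.symm.trans hx2))
    · exact hmc j hj i (hx2.symm.trans hx1)
    · exact hmc i hi j (hx1.symm.trans hx2)
    · exact hij (hm hi hj (hx1.symm.trans hx2))
  · have hcm : ∀ i, c i ∈ (if i ∈ I then {c i} else {c i, m i} : Set V) := fun i => by
      split_ifs <;> simp
    by_cases hi : i ∈ I
    · have hj : j ∉ I := fun hj => hI i hi j hj hij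
      exact ⟨c i, hcm i, m j, by simp [hj], (h j hj i).symm⟩
    · exact ⟨m i, by simp [hi], c j, hcm j, h i hi j⟩

/-- All but at most `#L` branch sets of a model avoid `L`. -/
lemma card_branch_sets_avoiding [Fintype W] {B : W → Set V}
    (hB : ∀ i j, i ≠ j → Disjoint (B i) (B j)) (L : Finset V) :
    Fintype.card W ≤ L.card + (Finset.univ.filter fun i => ∀ l ∈ L, l ∉ B i).card := by
  have h1 : (Finset.univ.filter fun i => ¬ ∀ l ∈ L, l ∉ B i).card ≤ L.card := by
    have h2 : ∀ i ∈ Finset.univ.filter fun i => ¬ ∀ l ∈ L, l ∉ B i, ∃ l ∈ L, l ∈ B i := by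
      intro i hi
      simpa using hi
    rcases isEmpty_or_nonempty V with hV | hV
    · rw [Finset.filter_false_of_mem]
      · simp
      · exact fun i _ h => h fun l => (hV.false l).elim
    choose! f hf using h2
    refine Finset.card_le_card_of_injOn f (fun i hi => (hf i hi).1) fun i hi j hj hij => ?_
    by_contra hne
    exact Set.disjoint_left.1 (hB i j hne) (hf i hi).2 (hij ▸ (hf j hj).2)
  have := Finset.card_filter_add_card_filter_not (s := (Finset.univ : Finset W))
    (fun i => ∀ l ∈ L, l ∉ B i)
  rw [Finset.card_univ] at this
  omega

lemma completeMinus_adj {r : ℕ} {H : SimpleGraph (Fin r)} {i j : Fin r} :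
    (completeMinus H).Adj i j ↔ i ≠ j ∧ ¬ H.Adj i j := by
  simp [completeMinus]

/-- If the vertices outside `L` are independent, `L` being small, there is no `K_r - E(H)` minor. -/
lemma not_isMinor_of_independent {r : ℕ} {H : SimpleGraph (Fin r)} {G : SimpleGraph V}
    (L : Finset V) (hL : L.card + H.cliqueNum < r) (hG : ∀ u v, u ∉ L → v ∉ L → ¬ G.Adj u v) :
    ¬ IsMinor (completeMinus H) G := by
  rintro ⟨B, h1, h2, h3⟩
  have hcard := card_branch_sets_avoiding h2 L
  rw [Fintype.card_fin] at hcard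
  have hcl : H.IsClique (Finset.univ.filter fun i => ∀ l ∈ L, l ∉ B i : Finset (Fin r)) := by
    intro i hi j hj hij
    simp only [Finset.coe_filter, Finset.mem_univ, true_and, Set.mem_ofPred_eq] at hi hj
    by_contra hn
    obtain ⟨x, hx, y, hy, hxy⟩ := h3 i j (completeMinus_adj.2 ⟨hij, hn⟩)
    exact hG x y (fun h => hi x h hx) (fun h => hj y h hy) hxy
  have := IsClique.card_le_cliqueNum (tc := hcl)
  omega

/-- If the edges outside `L` are pairwise disjoint, `L` being small, there is no `K_r - E(H)` minor
for a matching `H`. -/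
lemma not_isMinor_of_edgesDisjoint {r : ℕ} {H : SimpleGraph (Fin r)} {G : SimpleGraph V}
    (hH : EdgesDisjoint H) (L : Finset V) (hL : L.card + 3 ≤ r)
    (hG : ∀ u v w, u ∉ L → v ∉ L → w ∉ L → G.Adj u v → G.Adj u w → v = w) :
    ¬ IsMinor (completeMinus H) G := by
  rintro ⟨B, h1, h2, h3⟩
  have hcard := card_branch_sets_avoiding h2 L
  rw [Fintype.card_fin] at hcard
  obtain ⟨a, b, c, ha, hb, hc, hab, hac, hbc⟩ := Finset.two_lt_card_iff.1
    (show 2 < (Finset.univ.filter fun i => ∀ l ∈ L, l ∉ B i).card by omega)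
  simp only [Finset.mem_filter, Finset.mem_univ, true_and] at ha hb hc
  -- A connected set outside L joined to two other such sets contains a vertex with two neighbours
  -- outside L. Since `H` is a matching, one of any three indices is joined in `completeMinus H` to
  -- both others.
  have key : ∀ i j k, (∀ l ∈ L, l ∉ B i) → (∀ l ∈ L, l ∉ B j) → (∀ l ∈ L, l ∉ B k) →
      i ≠ j → i ≠ k → j ≠ k → ¬ H.Adj i j → ¬ H.Adj i k → False := by
    intro i j k hi hj hk hij hik hjk hnij hnik
    obtain ⟨x, hx, y, hy, hxy⟩ := h3 i j (completeMinus_adj.2 ⟨hij, hnij⟩)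
    obtain ⟨x', hx', z, hz, hxz⟩ := h3 i k (completeMinus_adj.2 ⟨hik, hnik⟩)
    have hxL := fun h => hi x h hx
    have hyL := fun h => hj y h hy
    have hzL := fun h => hk z h hz
    by_cases hxx : x = x'
    · subst hxx
      obtain rfl := hG x y z hxL hyL hzL hxy hxz
      exact Set.disjoint_left.1 (h2 j k hjk) hy hz
    · obtain ⟨w, hw, hxw⟩ := exists_adj_of_connected (h1 i) hx hx' hxx
      obtain rfl := hG x y w hxL hyL (fun h => hi w h hw) hxy hxw
      exact Set.disjoint_left.1 (h2 i j hij) hw hy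
  by_cases hHab : H.Adj a b
  · refine key c a b hc ha hb hac.symm hbc.symm hab (fun h => hbc ?_) (fun h => hac ?_)
    · exact hH a b c hHab h.symm
    · exact hH b a c hHab.symm h.symm
  · by_cases hHac : H.Adj a c
    · refine key b a c hb ha hc hab.symm hbc hac (fun h => hHab h.symm) (fun h => hab ?_)
      exact hH c a b hHac.symm h.symm
    · exact key a b c ha hb hc hab hac hbc hHab hHac

end Minors

/-! ### Sparsity of graphs with a forbidden minor -/

section Sparse
open scoped Classical

universe u

/-- The number of ordered pairs of adjacent vertices in `X`. -/
noncomputable def adjPairs {V : Type*} (G : SimpleGraph V) (X : Finset V) : ℕ :=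
  ∑ u ∈ X, (X.filter (G.Adj u)).card

variable {V : Type*}

lemma adjPairs_insert (G : SimpleGraph V) {Z : Finset V} {v : V} (hv : v ∉ Z) :
    adjPairs G (insert v Z) = adjPairs G Z + 2 * (Z.filter (G.Adj v)).card := by
  have h1 : ∀ u ∈ Z, ((insert v Z).filter (G.Adj u)).card
      = (Z.filter (G.Adj u)).card + if G.Adj v u then 1 else 0 := by
    intro u _
    rw [Finset.filter_insert]
    by_cases h : G.Adj u v
    · rw [if_pos h, if_pos h.symm, Finset.card_insert_of_notMem (by simp [hv])]
    · rw [if_neg h, if_neg (fun h' => h h'.symm), add_zero]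
  have h2 : (insert v Z).filter (G.Adj v) = Z.filter (G.Adj v) := by
    rw [Finset.filter_insert, if_neg G.irrefl]
  rw [adjPairs, Finset.sum_insert hv, h2, Finset.sum_congr rfl h1, Finset.sum_add_distrib,
    ← Finset.card_filter, adjPairs]
  ring

/-- A set of sufficiently large average degree contains a model of a complete graph. -/
lemma exists_complete_model (r : ℕ) : ∃ k : ℕ, ∀ (V : Type u) (G : SimpleGraph V) (X : Finset V),
    X.Nonempty → k * X.card ≤ adjPairs G X → ∃ B : Fin r → Finset V, (∀ i, B i ⊆ X) ∧
      (∀ i, (G.induce (B i : Set V)).Connected) ∧ (∀ i j, i ≠ j → Disjoint (B i) (B j)) ∧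
      ∀ i j, i ≠ j → ∃ x ∈ B i, ∃ y ∈ B j, G.Adj x y := by
  induction r with
  | zero => exact ⟨0, fun V G X _ _ => ⟨fun i => i.elim0, fun i => i.elim0, fun i => i.elim0,
      fun i => i.elim0, fun i => i.elim0⟩⟩
  | succ r ih =>
    obtain ⟨k, hk⟩ := ih
    refine ⟨2 * k + 2, fun V G X => ?_⟩
    induction X using Finset.strongInduction with
    | H X ihX =>
      intro hX hE
      let N : Finset V → Finset V := fun U => (X \ U).filter fun v => ∃ u ∈ U, G.Adj u v
      -- Contract the connected set U to one vertex: the right side is twice the number of edges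
      -- left, and the left side is the density bound times the number of vertices. A largest such U
      -- is chosen.
      let P : Finset V → Prop := fun U => (G.induce (U : Set V)).Connected ∧
        (2 * k + 2) * ((X \ U).card + 1) ≤ adjPairs G (X \ U) + 2 * (N U).card
      have hne : (X.powerset.filter P).Nonempty := by
        obtain ⟨u, hu⟩ := hX
        refine ⟨{u}, ?_⟩
        rw [Finset.mem_filter, Finset.mem_powerset, Finset.singleton_subset_iff]
        have h1 : insert u (X \ {u}) = X := by
          rw [Finset.sdiff_singleton_eq_erase, Finset.insert_erase hu]
        have h2 : u ∉ X \ {u} := by simp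
        have h3 := adjPairs_insert G h2
        have h4 : N {u} = (X \ {u}).filter (G.Adj u) := by
          simp only [N, Finset.mem_singleton, exists_eq_left]
        have h5 := Finset.card_insert_of_notMem h2
        rw [h1] at h3 h5
        refine ⟨hu, ?_, ?_⟩
        · rw [Finset.coe_singleton]
          exact connected_singleton G u
        · rw [h4, ← h3, ← h5]
          exact hE
      obtain ⟨U, hU, hmax⟩ := Finset.exists_max_image _ Finset.card hne
      rw [Finset.mem_filter, Finset.mem_powerset] at hU
      obtain ⟨hUX, hUc, hUP⟩ := hU
      by_cases hN : (N U).Nonempty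
      -- By maximality, contracting v into U as well must lose more than k + 1 edges: the edge to v
      -- itself and one for each neighbour that v shares with U. So `N U` is dense enough for
      -- induction, and U serves as the extra branch set.
      · have hdeg : ∀ v ∈ N U, k ≤ ((N U).filter (G.Adj v)).card := by
          intro v hv
          have hv' := hv
          rw [Finset.mem_filter, Finset.mem_sdiff] at hv'
          obtain ⟨⟨hvX, hvU⟩, u, huU, huv⟩ := hv'
          have hnot : ¬ P (insert v U) := by
            intro hP
            have := hmax (insert v U) (by
              rw [Finset.mem_filter, Finset.mem_powerset]
              exact ⟨Finset.insert_subset hvX hUX, hP⟩)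
            rw [Finset.card_insert_of_notMem hvU] at this
            omega
          have hc : (G.induce ((insert v U : Finset V) : Set V)).Connected := by
            rw [Finset.coe_insert]
            exact connected_insert hUc huU huv
          have hlt := not_le.1 fun h => hnot ⟨hc, h⟩
          have hY : X \ U = insert v (X \ insert v U) := by
            ext z
            simp only [Finset.mem_sdiff, Finset.mem_insert]
            by_cases hz : z = v
            · subst hz
              simp [hvX, hvU]
            · simp [hz]
          have hvY : v ∉ X \ insert v U := by simp
          have e1 := adjPairs_insert G hvY
          have e2 := Finset.card_insert_of_notMem hvY
          rw [← hY] at e1 e2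
          have e3 : N (insert v U) = (N U).erase v ∪ ((X \ U) \ N U).filter (G.Adj v) := by
            ext z
            simp only [N, Finset.mem_filter, Finset.mem_sdiff, Finset.mem_insert, Finset.mem_union,
              Finset.mem_erase, exists_eq_or_imp]
            by_cases hz : z = v
            · subst hz
              simp
            · by_cases h1 : ∃ a ∈ U, G.Adj a z
              · simp only [h1, hz]
                tauto
              · simp only [h1, hz]
                tauto
          have e4 : (N (insert v U)).card
              = (N U).card - 1 + (((X \ U) \ N U).filter (G.Adj v)).card := by
            rw [e3, Finset.card_union_of_disjoint, Finset.card_erase_of_mem hv]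
            refine Finset.disjoint_left.2 fun z hz hz' => ?_
            rw [Finset.mem_filter, Finset.mem_sdiff] at hz'
            exact hz'.1.2 (Finset.mem_of_mem_erase hz)
          have e5 : ((X \ insert v U).filter (G.Adj v)).card
              = ((N U).filter (G.Adj v)).card + (((X \ U) \ N U).filter (G.Adj v)).card := by
            rw [← Finset.card_union_of_disjoint, ← Finset.filter_union,
              Finset.union_sdiff_of_subset (Finset.filter_subset _ _), hY, Finset.filter_insert,
              if_neg G.irrefl]
            exact Finset.disjoint_filter_filter Finset.disjoint_sdiff
          have e6 : 0 < (N U).card := Finset.card_pos.2 ⟨v, hv⟩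
          rw [e4] at hlt
          rw [← e2] at hlt
          rw [e1, e5] at hUP
          have e7 : (2 * k + 2) * ((X \ U).card + 1) = (2 * k + 2) * (X \ U).card + (2 * k + 2) := by
            ring
          omega
        have hNE : k * (N U).card ≤ adjPairs G (N U) := by
          rw [mul_comm, ← smul_eq_mul]
          exact Finset.card_nsmul_le_sum _ _ _ hdeg
        obtain ⟨B, hB1, hB2, hB3, hB4⟩ := hk V G (N U) hN hNE
        have hNX : N U ⊆ X \ U := Finset.filter_subset _ _
        have hadj : ∀ i, ∃ x ∈ U, ∃ y ∈ B i, G.Adj x y := by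
          intro i
          obtain ⟨y, hy⟩ := (hB2 i).nonempty
          obtain ⟨u, hu, huy⟩ := (Finset.mem_filter.1 (hB1 i hy)).2
          exact ⟨u, hu, y, hy, huy⟩
        have hdis : ∀ i, Disjoint U (B i) := fun i =>
          Finset.disjoint_left.2 fun x hx hx' => (Finset.mem_sdiff.1 (hNX (hB1 i hx'))).2 hx
        refine ⟨Fin.cons U B, ?_, ?_, ?_, ?_⟩
        · intro i
          refine Fin.cases hUX (fun i => ?_) i
          exact (hB1 i).trans (hNX.trans Finset.sdiff_subset)
        · intro i
          refine Fin.cases hUc (fun i => hB2 i) i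
        · intro i j
          refine Fin.cases (Fin.cases (fun h => absurd rfl h) (fun j _ => hdis j) j) (fun i => ?_) i
          refine Fin.cases (fun _ => (hdis i).symm) (fun j h => ?_) j
          exact hB3 i j fun e => h (by rw [e])
        · intro i j
          refine Fin.cases (Fin.cases (fun h => absurd rfl h) (fun j _ => hadj j) j) (fun i => ?_) i
          refine Fin.cases (fun _ => ?_) (fun j h => ?_) j
          · obtain ⟨x, hx, y, hy, h⟩ := hadj i
            exact ⟨y, hy, x, hx, h.symm⟩
          · exact hB4 i j fun e => h (by rw [e])
      -- Here U has no neighbours left in X, so `X \ U` inherits the density and is smaller.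
      · rw [Finset.not_nonempty_iff_eq_empty] at hN
        rw [hN, Finset.card_empty, mul_zero, add_zero] at hUP
        have hYne : (X \ U).Nonempty := by
          rw [Finset.nonempty_iff_ne_empty]
          intro h
          rw [h] at hUP
          simp [adjPairs] at hUP
        obtain ⟨u⟩ := hUc.nonempty
        have hss : X \ U ⊂ X := Finset.sdiff_ssubset hUX ⟨u, u.2⟩
        obtain ⟨B, hB1, hB2⟩ := ihX _ hss hYne (le_trans (Nat.mul_le_mul_left _ (Nat.le_succ _)) hUP)
        exact ⟨B, fun i => (hB1 i).trans Finset.sdiff_subset, hB2⟩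

/-- Graphs without a fixed minor are sparse, uniformly over their vertex subsets. -/
lemma exists_adjPairs_le {r : ℕ} (F : SimpleGraph (Fin r)) : ∃ k : ℕ, 0 < k ∧
    ∀ (V : Type u) (G : SimpleGraph V), ¬ IsMinor F G → ∀ X : Finset V,
      adjPairs G X ≤ k * X.card := by
  obtain ⟨k, hk⟩ := exists_complete_model.{u} r
  refine ⟨k + 1, Nat.succ_pos k, fun V G hG X => ?_⟩
  by_contra hX
  push Not at hX
  have hne : X.Nonempty := by
    rw [Finset.nonempty_iff_ne_empty]
    rintro rfl
    simp [adjPairs] at hX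
  obtain ⟨B, -, hB2, hB3, hB4⟩ := hk V G X hne
    ((Nat.mul_le_mul_right _ (Nat.le_succ k)).trans hX.le)
  exact hG ⟨fun i => B i, hB2, fun i j hij => Finset.disjoint_coe.2 (hB3 i j hij),
    fun i j hij => hB4 i j hij.ne⟩

end Sparse

/-! ### The spectral radius as a Rayleigh maximum, and the Perron vector -/

section Spectral
open scoped Classical

variable {V : Type*} [Fintype V]

/-- The sum of `x` over the neighbours of `v`. -/
noncomputable def nbrSum (G : SimpleGraph V) (x : V → ℝ) (v : V) : ℝ :=
  ∑ u, if G.Adj v u then x u else 0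

/-- The quadratic form of the adjacency matrix. -/
noncomputable def adjForm (G : SimpleGraph V) (x : V → ℝ) : ℝ := ∑ v, x v * nbrSum G x v

lemma mulVec_adjMatrix_apply (G : SimpleGraph V) (x : V → ℝ) (v : V) :
    (G.adjMatrix ℝ).mulVec x v = nbrSum G x v := by
  simp [Matrix.mulVec, dotProduct, adjMatrix_apply, nbrSum]

lemma nbrSum_add (G : SimpleGraph V) (x y : V → ℝ) (v : V) :
    nbrSum G (x + y) v = nbrSum G x v + nbrSum G y v := by
  rw [nbrSum, nbrSum, nbrSum, ← Finset.sum_add_distrib]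
  exact Finset.sum_congr rfl fun u _ => by split_ifs <;> simp

lemma nbrSum_smul (G : SimpleGraph V) (t : ℝ) (x : V → ℝ) (v : V) :
    nbrSum G (t • x) v = t * nbrSum G x v := by
  rw [nbrSum, nbrSum, Finset.mul_sum]
  exact Finset.sum_congr rfl fun u _ => by split_ifs <;> simp

lemma sum_mul_nbrSum_comm (G : SimpleGraph V) (x y : V → ℝ) :
    ∑ v, x v * nbrSum G y v = ∑ v, y v * nbrSum G x v := by
  simp only [nbrSum, Finset.mul_sum]
  rw [Finset.sum_comm]
  refine Finset.sum_congr rfl fun u _ => Finset.sum_congr rfl fun v _ => ?_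
  simp only [G.adj_comm u v]
  split_ifs <;> ring

lemma adjForm_add (G : SimpleGraph V) (x y : V → ℝ) :
    adjForm G (x + y) = adjForm G x + 2 * ∑ v, y v * nbrSum G x v + adjForm G y := by
  have h := sum_mul_nbrSum_comm G x y
  simp only [adjForm, nbrSum_add, Pi.add_apply, add_mul, mul_add, Finset.sum_add_distrib]
  rw [h]
  ring

lemma adjForm_smul (G : SimpleGraph V) (t : ℝ) (x : V → ℝ) :
    adjForm G (t • x) = t ^ 2 * adjForm G x := by
  rw [adjForm, adjForm, Finset.mul_sum]
  refine Finset.sum_congr rfl fun v _ => ?_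
  rw [nbrSum_smul, Pi.smul_apply, smul_eq_mul]
  ring

lemma abs_adjForm_le (G : SimpleGraph V) (x : V → ℝ) :
    |adjForm G x| ≤ adjForm G fun v => |x v| := by
  refine (Finset.abs_sum_le_sum_abs _ _).trans (Finset.sum_le_sum fun v _ => ?_)
  rw [abs_mul]
  refine mul_le_mul_of_nonneg_left ((Finset.abs_sum_le_sum_abs _ _).trans
    (Finset.sum_le_sum fun u _ => ?_)) (abs_nonneg _)
  split_ifs <;> simp

lemma continuous_adjForm (G : SimpleGraph V) : Continuous (adjForm G) := by
  unfold adjForm nbrSum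
  refine continuous_finsetSum _ fun v _ => (continuous_apply v).mul ?_
  refine continuous_finsetSum _ fun u _ => ?_
  split_ifs
  exacts [continuous_apply u, continuous_const]

/-- A nonnegative vector attaining the maximum of the Rayleigh quotient. -/
lemma exists_rayleigh_max [Nonempty V] (G : SimpleGraph V) : ∃ (ρ : ℝ) (x : V → ℝ), 0 ≤ ρ ∧
    (∀ v, 0 ≤ x v) ∧ ∑ v, x v ^ 2 = 1 ∧ adjForm G x = ρ ∧
    ∀ y : V → ℝ, adjForm G y ≤ ρ * ∑ v, y v ^ 2 := by
  let S : Set (V → ℝ) := {y | ∑ v, y v ^ 2 = 1}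
  have hcont : Continuous fun y : V → ℝ => ∑ v, y v ^ 2 :=
    continuous_finsetSum _ fun v _ => (continuous_apply v).pow 2
  have hS : IsCompact S := by
    refine Metric.isCompact_of_isClosed_isBounded (isClosed_eq hcont continuous_const) ?_
    refine (Metric.isBounded_closedBall (x := (0 : V → ℝ)) (r := 1)).subset fun y hy => ?_
    rw [mem_closedBall_zero_iff, pi_norm_le_iff_of_nonneg zero_le_one]
    intro v
    have h1 : y v ^ 2 ≤ ∑ v, y v ^ 2 :=
      Finset.single_le_sum (f := fun v => y v ^ 2) (fun v _ => sq_nonneg (y v)) (Finset.mem_univ v)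
    have h2 : ∑ v, y v ^ 2 = 1 := hy
    rw [h2] at h1
    exact abs_le_one_iff_mul_self_le_one.2 (by nlinarith)
  have hne : S.Nonempty := by
    obtain ⟨v⟩ := ‹Nonempty V›
    refine ⟨Pi.single v 1, ?_⟩
    change ∑ u, (Pi.single v 1 : V → ℝ) u ^ 2 = 1
    rw [Finset.sum_eq_single v]
    · simp
    · intro u _ hu
      simp [hu]
    · simp
  obtain ⟨x, hx, hmax⟩ := hS.exists_isMaxOn hne (continuous_adjForm G).continuousOn
  have habs : (fun v => |x v|) ∈ S := by
    change ∑ v, |x v| ^ 2 = 1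
    simp only [sq_abs]
    exact hx
  have h0 : |adjForm G x| ≤ adjForm G fun v => |x v| := abs_adjForm_le G x
  refine ⟨adjForm G fun v => |x v|, fun v => |x v|, (abs_nonneg _).trans h0,
    fun v => abs_nonneg _, habs, rfl, fun y => ?_⟩
  have hy0 : 0 ≤ ∑ v, y v ^ 2 := Finset.sum_nonneg fun v _ => sq_nonneg _
  rcases hy0.eq_or_lt with hy | hy
  · have : y = 0 := by
      funext v
      have := (Finset.sum_eq_zero_iff_of_nonneg fun v _ => sq_nonneg (y v)).1 hy.symm v
        (Finset.mem_univ v)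
      simpa using this
    subst this
    simp [adjForm]
  · set s := ∑ v, y v ^ 2 with hs
    have hsq : Real.sqrt s ^ 2 = s := Real.sq_sqrt hy0
    have hmem : ((Real.sqrt s)⁻¹ • y) ∈ S := by
      change ∑ v, ((Real.sqrt s)⁻¹ * y v) ^ 2 = 1
      simp only [mul_pow]
      rw [← Finset.mul_sum, ← hs, inv_pow, hsq, inv_mul_cancel₀ hy.ne']
    have h1 : adjForm G ((Real.sqrt s)⁻¹ • y) ≤ adjForm G x := hmax hmem
    rw [adjForm_smul, inv_pow, hsq, inv_mul_le_iff₀ hy] at h1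
    have h2 := (le_abs_self _).trans h0
    rw [mul_comm]
    exact h1.trans (mul_le_mul_of_nonneg_left h2 hy0)

/-- The spectral radius is the maximum of the Rayleigh quotient, and it has a nonnegative
eigenvector with maximal entry `1`. -/
lemma exists_perron [Nonempty V] (G : SimpleGraph V) : ∃ ρ : ℝ, 0 ≤ ρ ∧
    graphSpectralRadius G = ENNReal.ofReal ρ ∧ (∀ y : V → ℝ, adjForm G y ≤ ρ * ∑ v, y v ^ 2) ∧
    ∃ x : V → ℝ, (∀ v, 0 ≤ x v) ∧ (∀ v, x v ≤ 1) ∧ (∃ v, x v = 1) ∧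
      ∀ v, nbrSum G x v = ρ * x v := by
  obtain ⟨ρ, x, hρ, hx, hx1, hxρ, hmax⟩ := exists_rayleigh_max G
  have heig : ∀ v, nbrSum G x v = ρ * x v := by
    intro v
    -- Perturbing the maximiser in coordinate v: the linear term in t must vanish.
    have h1 : ∀ t : ℝ, 2 * t * (nbrSum G x v - ρ * x v) ≤ ρ * t ^ 2 := by
      intro t
      have h2 := hmax (x + t • Pi.single v 1)
      have h3 : adjForm G (Pi.single v 1) = 0 := by
        rw [adjForm, Finset.sum_eq_single v]
        · rw [nbrSum, Finset.sum_eq_zero, mul_zero]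
          intro u _
          by_cases hu : u = v
          · subst hu
            simp
          · simp [hu]
        · intro u _ hu
          simp [hu]
        · simp
      have h4 : ∑ u, (t • Pi.single v 1 : V → ℝ) u * nbrSum G x u = t * nbrSum G x v := by
        rw [Finset.sum_eq_single v]
        · simp
        · intro u _ hu
          simp [hu]
        · simp
      have h5 : ∑ u, (x + t • Pi.single v 1 : V → ℝ) u ^ 2 = 1 + 2 * t * x v + t ^ 2 := by
        have h6 : ∀ u, (x + t • Pi.single v 1 : V → ℝ) u ^ 2
            = x u ^ 2 + if u = v then 2 * t * x v + t ^ 2 else 0 := by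
          intro u
          by_cases hu : u = v
          · subst hu
            simp
            ring
          · simp [hu]
        simp only [h6, Finset.sum_add_distrib, hx1, Finset.sum_ite_eq', Finset.mem_univ, if_true]
        ring
      rw [adjForm_add, adjForm_smul, h3, h4, h5, hxρ] at h2
      linarith
    set d := nbrSum G x v - ρ * x v with hd
    -- The denominator ρ + 1, rather than ρ, keeps this choice of t valid when ρ = 0.
    have h2 := h1 (d / (ρ + 1))
    have h3 : 0 < ρ + 1 := by linarith
    have h4 : 2 * (d / (ρ + 1)) * d * (ρ + 1) ^ 2 ≤ ρ * (d / (ρ + 1)) ^ 2 * (ρ + 1) ^ 2 :=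
      mul_le_mul_of_nonneg_right h2 (sq_nonneg _)
    have h5 : 2 * (d / (ρ + 1)) * d * (ρ + 1) ^ 2 = 2 * d ^ 2 * (ρ + 1) := by field_simp
    have h6 : ρ * (d / (ρ + 1)) ^ 2 * (ρ + 1) ^ 2 = ρ * d ^ 2 := by field_simp
    rw [h5, h6] at h4
    have h7 : d = 0 := by
      have : d ^ 2 ≤ 0 := by nlinarith [mul_nonneg hρ (sq_nonneg d), sq_nonneg d]
      exact pow_eq_zero_iff (two_ne_zero) |>.1 (le_antisymm this (sq_nonneg d))
    linarith
  have hspec : ∀ μ : ℝ, μ ∈ spectrum ℝ (G.adjMatrix ℝ) ↔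
      ∃ v : V → ℝ, v ≠ 0 ∧ ∀ u, nbrSum G v u = μ * v u := by
    intro μ
    rw [← Matrix.spectrum_toLin', ← Module.End.hasEigenvalue_iff_mem_spectrum]
    constructor
    · intro h
      obtain ⟨v, hv⟩ := h.exists_hasEigenvector
      refine ⟨v, hv.2, fun u => ?_⟩
      have := congrFun hv.apply_eq_smul u
      rwa [Matrix.toLin'_apply, mulVec_adjMatrix_apply] at this
    · rintro ⟨v, hv, h⟩
      refine Module.End.hasEigenvalue_of_hasEigenvector (x := v) ⟨?_, hv⟩
      rw [Module.End.mem_eigenspace_iff]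
      funext u
      rw [Matrix.toLin'_apply, mulVec_adjMatrix_apply, h u]
      rfl
  have hx0 : x ≠ 0 := by
    rintro rfl
    simp at hx1
  have hrad : graphSpectralRadius G = ENNReal.ofReal ρ := by
    apply le_antisymm
    · refine iSup₂_le fun μ hμ => ?_
      obtain ⟨v, hv, h⟩ := (hspec μ).1 hμ
      have h1 : adjForm G v = μ * ∑ u, v u ^ 2 := by
        rw [adjForm, Finset.mul_sum]
        exact Finset.sum_congr rfl fun u _ => by rw [h u]; ring
      have hpos : 0 < ∑ u, v u ^ 2 := by
        obtain ⟨u, hu⟩ := Function.ne_iff.1 hv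
        exact Finset.sum_pos' (fun u _ => sq_nonneg _) ⟨u, Finset.mem_univ u, by
          have : v u ≠ 0 := hu
          positivity⟩
      have h2 := (abs_adjForm_le G v).trans (hmax fun u => |v u|)
      simp only [sq_abs] at h2
      rw [h1, abs_mul, abs_of_pos hpos] at h2
      have h3 := le_of_mul_le_mul_right h2 hpos
      rw [← enorm_eq_nnnorm, ← ofReal_norm, Real.norm_eq_abs]
      exact ENNReal.ofReal_le_ofReal h3
    · have h1 : ρ ∈ spectrum ℝ (G.adjMatrix ℝ) := (hspec ρ).2 ⟨x, hx0, heig⟩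
      have h2 : ENNReal.ofReal ρ = (‖ρ‖₊ : ENNReal) := by
        rw [← enorm_eq_nnnorm, ← ofReal_norm, Real.norm_eq_abs, abs_of_nonneg hρ]
      rw [h2]
      exact le_iSup₂ (f := fun (k : ℝ) (_ : k ∈ spectrum ℝ (G.adjMatrix ℝ)) => (‖k‖₊ : ENNReal))
        ρ h1
  obtain ⟨m, -, hm⟩ := Finset.exists_max_image Finset.univ x Finset.univ_nonempty
  have hm0 : 0 < x m := by
    refine (hx m).lt_of_ne fun h => hx0 ?_
    funext u
    exact le_antisymm ((hm u (Finset.mem_univ u)).trans_eq h.symm) (hx u)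
  refine ⟨ρ, hρ, hrad, hmax, (x m)⁻¹ • x, fun v => ?_, fun v => ?_, ⟨m, ?_⟩, fun v => ?_⟩
  · exact mul_nonneg (inv_nonneg.2 hm0.le) (hx v)
  · change (x m)⁻¹ * x v ≤ 1
    rw [inv_mul_le_iff₀ hm0, mul_one]
    exact hm v (Finset.mem_univ v)
  · exact inv_mul_cancel₀ hm0.ne'
  · rw [nbrSum_smul, heig v, Pi.smul_apply, smul_eq_mul]
    ring

lemma graphSpectralRadius_congr {V' : Type*} [Fintype V'] {G : SimpleGraph V}
    {G' : SimpleGraph V'} (e : G ≃g G') : graphSpectralRadius G = graphSpectralRadius G' := by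
  have h : (G'.adjMatrix ℝ) = Matrix.reindexAlgEquiv ℝ ℝ e.toEquiv (G.adjMatrix ℝ) := by
    ext i j
    have h1 : G.Adj (e.toEquiv.symm i) (e.toEquiv.symm j) ↔ G'.Adj i j := by
      rw [← e.map_adj_iff]
      exact iff_of_eq (congrArg₂ G'.Adj (e.toEquiv.apply_symm_apply i)
        (e.toEquiv.apply_symm_apply j))
    simp only [Matrix.coe_reindexAlgEquiv, Matrix.reindex_apply, Matrix.submatrix_apply,
      adjMatrix_apply, h1]
  rw [graphSpectralRadius, graphSpectralRadius, h, spectralRadius, spectralRadius,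
    AlgEquiv.spectrum_eq]

end Spectral

/-! ### Comparing spectral radii through test vectors -/

section Gain
open scoped Classical

variable {V : Type*} [Fintype V]

lemma nbrSum_nonneg (G : SimpleGraph V) {x : V → ℝ} (hx : ∀ v, 0 ≤ x v) (v : V) :
    0 ≤ nbrSum G x v :=
  Finset.sum_nonneg fun u _ => by split_ifs; exacts [hx u, le_rfl]

lemma adjForm_nonneg (G : SimpleGraph V) {x : V → ℝ} (hx : ∀ v, 0 ≤ x v) : 0 ≤ adjForm G x :=
  Finset.sum_nonneg fun v _ => mul_nonneg (hx v) (nbrSum_nonneg G hx v)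

lemma nbrSum_eq_sum_filter (G : SimpleGraph V) (x : V → ℝ) (v : V) :
    nbrSum G x v = ∑ u ∈ Finset.univ.filter (G.Adj v), x u := by
  rw [nbrSum, Finset.sum_filter]

lemma sum_le_nbrSum (G : SimpleGraph V) {x : V → ℝ} (hx : ∀ v, 0 ≤ x v) {v : V} {T : Finset V}
    (hT : ∀ u ∈ T, G.Adj v u) : ∑ u ∈ T, x u ≤ nbrSum G x v := by
  rw [nbrSum_eq_sum_filter]
  exact Finset.sum_le_sum_of_subset_of_nonneg (fun u hu => by simpa using hT u hu)
    fun u _ _ => hx u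

/-- Only edges within the support of x matter. This is what permits `G'` to lose the edges at
reattached vertices, on which the test vector is set to zero. -/
lemma adjForm_mono {G G' : SimpleGraph V} {x : V → ℝ} (hx : ∀ v, 0 ≤ x v)
    (h : ∀ u v, x u ≠ 0 → x v ≠ 0 → G.Adj u v → G'.Adj u v) : adjForm G x ≤ adjForm G' x := by
  refine Finset.sum_le_sum fun v _ => ?_
  simp only [nbrSum, Finset.mul_sum]
  refine Finset.sum_le_sum fun u _ => ?_
  by_cases hv : x v = 0
  · simp [hv]
  by_cases hu : x u = 0
  · simp [hu]
  by_cases h1 : G.Adj v u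
  · rw [if_pos h1, if_pos (h v u hv hu h1)]
  · rw [if_neg h1, mul_zero]
    exact mul_nonneg (hx v) (by split_ifs; exacts [hx u, le_rfl])

lemma adjForm_add_le {G G' : SimpleGraph V} {x : V → ℝ} (hx : ∀ v, 0 ≤ x v)
    (h : ∀ u v, x u ≠ 0 → x v ≠ 0 → G.Adj u v → G'.Adj u v) {a b : V} (hab : ¬ G.Adj a b)
    (hab' : G'.Adj a b) : adjForm G x + 2 * (x a * x b) ≤ adjForm G' x := by
  have h1 : adjForm G x + ∑ v, ∑ u, ((if v = a then if u = b then x v * x u else 0 else 0) +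
      (if v = b then if u = a then x v * x u else 0 else 0)) ≤ adjForm G' x := by
    rw [adjForm, adjForm, ← Finset.sum_add_distrib]
    refine Finset.sum_le_sum fun v _ => ?_
    simp only [nbrSum, Finset.mul_sum]
    rw [← Finset.sum_add_distrib]
    refine Finset.sum_le_sum fun u _ => ?_
    have hne : a ≠ b := hab'.ne
    by_cases hc1 : v = a ∧ u = b
    · obtain ⟨rfl, rfl⟩ := hc1
      simp [hab, hab', hne]
    by_cases hc2 : v = b ∧ u = a
    · obtain ⟨rfl, rfl⟩ := hc2
      have h3 : ¬ G.Adj v u := fun h => hab h.symm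
      simp [h3, hab'.symm, hne.symm]
    have e1 : (if v = a then if u = b then x v * x u else 0 else 0) = 0 := by
      rw [← ite_and, if_neg hc1]
    have e2 : (if v = b then if u = a then x v * x u else 0 else 0) = 0 := by
      rw [← ite_and, if_neg hc2]
    rw [e1, e2, add_zero, add_zero]
    by_cases hv : x v = 0
    · simp [hv]
    by_cases hu : x u = 0
    · simp [hu]
    by_cases h1 : G.Adj v u
    · rw [if_pos h1, if_pos (h v u hv hu h1)]
    · rw [if_neg h1, mul_zero]
      exact mul_nonneg (hx v) (by split_ifs; exacts [hx u, le_rfl])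
  have h2 : ∑ v, ∑ u, ((if v = a then if u = b then x v * x u else 0 else 0) +
      (if v = b then if u = a then x v * x u else 0 else 0)) = 2 * (x a * x b) := by
    have e : ∀ c d : V, ∑ v, ∑ u, (if v = c then if u = d then x v * x u else 0 else 0)
        = x c * x d := by
      intro c d
      rw [Finset.sum_eq_single c]
      · simp
      · intro v _ hv
        simp [hv]
      · simp
    simp only [Finset.sum_add_distrib, e]
    ring
  rwa [h2] at h1

/-- Comparison of a Perron vector of `G` with its modification on a graph `G'` in which the vertices
of `J` are adjacent exactly to the vertices of `L`. -/
lemma sum_sq_sub_sq_add_le_zero {G G' : SimpleGraph V} {x : V → ℝ} {ρ : ℝ} (hρ : 0 < ρ)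
    (hx : ∀ v, 0 ≤ x v) (heig : ∀ v, nbrSum G x v = ρ * x v)
    (hmax : ∀ y : V → ℝ, adjForm G' y ≤ ρ * ∑ v, y v ^ 2) {L J : Finset V} (hLJ : Disjoint L J)
    (hJ : ∀ j ∈ J, ∀ v, G'.Adj j v ↔ v ∈ L) {g : ℝ}
    (hg : adjForm G (fun v => if v ∈ J then 0 else x v) + g
      ≤ adjForm G' (fun v => if v ∈ J then 0 else x v)) :
    ∑ j ∈ J, ((∑ l ∈ L, x l) ^ 2 - (ρ * x j) ^ 2) + ρ * g ≤ 0 := by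
  have e1 : ∀ c S : ℝ, ρ * (c * (S / ρ) ^ 2) = c * (S ^ 2 / ρ) := fun c S => by field_simp
  have e2 : ∀ c S : ℝ, ρ * (c * (S ^ 2 / ρ)) = c * S ^ 2 := fun c S => by field_simp
  set z : V → ℝ := fun v => if v ∈ J then 0 else x v with hz
  set S := ∑ l ∈ L, x l with hS
  let p : V → ℝ := fun v => if v ∈ J then x v else 0
  -- On J the test vector takes the value that the eigenvalue equation would prescribe for a vertex
  -- adjacent exactly to L.
  let q : V → ℝ := fun v => if v ∈ J then S / ρ else 0
  have hS0 : 0 ≤ S := Finset.sum_nonneg fun l _ => hx l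
  have hxzp : x = z + p := by
    funext v
    by_cases hv : v ∈ J <;> simp [z, p, hv]
  have hp0 : ∀ v, 0 ≤ p v := fun v => by
    by_cases hv : v ∈ J <;> simp [p, hv, hx v]
  have hq0 : ∀ v, 0 ≤ q v := fun v => by
    by_cases hv : v ∈ J
    · simp only [q, hv, if_true]
      positivity
    · simp [q, hv]
  have hsq : ∑ v, x v ^ 2 = ∑ v, z v ^ 2 + ∑ v, p v ^ 2 := by
    rw [← Finset.sum_add_distrib]
    refine Finset.sum_congr rfl fun v _ => ?_
    by_cases hv : v ∈ J <;> simp [z, p, hv]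
  have hpx : ∑ v, p v * nbrSum G x v = ρ * ∑ v, p v ^ 2 := by
    rw [Finset.mul_sum]
    refine Finset.sum_congr rfl fun v _ => ?_
    rw [heig]
    by_cases hv : v ∈ J
    · simp only [p, hv, if_true]
      ring
    · simp [p, hv]
  have hpx' : ∑ v, p v * nbrSum G x v = ∑ v, p v * nbrSum G z v + adjForm G p := by
    rw [adjForm, ← Finset.sum_add_distrib]
    refine Finset.sum_congr rfl fun v _ => ?_
    rw [← mul_add, ← nbrSum_add, ← hxzp]
  have hxx : adjForm G x = ρ * ∑ v, x v ^ 2 := by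
    rw [adjForm, Finset.mul_sum]
    refine Finset.sum_congr rfl fun v _ => ?_
    rw [heig]
    ring
  have hxx' : adjForm G x = adjForm G z + 2 * ∑ v, p v * nbrSum G z v + adjForm G p := by
    conv_lhs => rw [hxzp]
    exact adjForm_add G z p
  have hpp := adjForm_nonneg G hp0
  have hqq := adjForm_nonneg G' hq0
  have hy := hmax (z + q)
  rw [adjForm_add] at hy
  have hqz : ∑ v, q v * nbrSum G' z v = J.card * (S ^ 2 / ρ) := by
    have : ∀ v, q v * nbrSum G' z v = if v ∈ J then S ^ 2 / ρ else 0 := by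
      intro v
      by_cases hv : v ∈ J
      · have h1 : nbrSum G' z v = S := by
          rw [nbrSum_eq_sum_filter, hS]
          have : Finset.univ.filter (G'.Adj v) = L := by
            ext u
            simp [hJ v hv u]
          rw [this]
          exact Finset.sum_congr rfl fun l hl => if_neg (Finset.disjoint_left.1 hLJ hl)
        rw [h1, if_pos hv]
        simp only [q, hv, if_true]
        ring
      · simp [q, hv]
    simp only [this]
    rw [Finset.sum_ite_mem, Finset.univ_inter, Finset.sum_const, nsmul_eq_mul]
  have hyy : ∑ v, (z + q) v ^ 2 = ∑ v, z v ^ 2 + J.card * (S / ρ) ^ 2 := by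
    have : ∀ v, (z + q) v ^ 2 = z v ^ 2 + if v ∈ J then (S / ρ) ^ 2 else 0 := by
      intro v
      by_cases hv : v ∈ J <;> simp [z, q, hv]
    simp only [this]
    rw [Finset.sum_add_distrib, Finset.sum_ite_mem, Finset.univ_inter, Finset.sum_const,
      nsmul_eq_mul]
  rw [hqz, hyy] at hy
  have hp2 : ∑ j ∈ J, (ρ * x j) ^ 2 = ρ ^ 2 * ∑ v, p v ^ 2 := by
    have : ∀ v, p v ^ 2 = if v ∈ J then x v ^ 2 else 0 := by
      intro v
      by_cases hv : v ∈ J <;> simp [p, hv]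
    simp only [this]
    rw [Finset.sum_ite_mem, Finset.univ_inter, Finset.mul_sum]
    exact Finset.sum_congr rfl fun v _ => by ring
  rw [Finset.sum_sub_distrib, Finset.sum_const, nsmul_eq_mul, hp2]
  rw [mul_add, e1] at hy
  -- The nonnegative forms of p in G and of q in `G'` are both discarded in the favourable
  -- direction.
  have key : J.card * (S ^ 2 / ρ) - ρ * ∑ v, p v ^ 2 + g ≤ 0 := by
    rw [hsq] at hxx
    linarith
  have := mul_le_mul_of_nonneg_left key hρ.le
  rw [mul_add, mul_sub, e2, mul_zero] at this
  linarith

/-- Adding edges to a graph with a dominating vertex strictly increases the spectral radius. -/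
lemma graphSpectralRadius_lt {G G' : SimpleGraph V} (h : G < G') {l : V}
    (hl : ∀ v, v ≠ l → G.Adj l v) : graphSpectralRadius G < graphSpectralRadius G' := by
  have : Nonempty V := ⟨l⟩
  obtain ⟨ρ, hρ, hG, -, x, hx, -, ⟨m, hm⟩, heig⟩ := exists_perron G
  obtain ⟨ρ', -, hG', hmax, -⟩ := exists_perron G'
  have hle : ∀ u v, G.Adj u v → x v ≤ ρ * x u := by
    intro u v huv
    rw [← heig]
    simpa using sum_le_nbrSum G hx (v := u) (T := {v}) (by simpa using huv)
  have hpos : ∀ u v, G.Adj u v → 0 < x v → 0 < x u := by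
    intro u v huv hv
    refine (hx u).lt_of_ne fun h0 => ?_
    have := hle u v huv
    rw [← h0, mul_zero] at this
    linarith
  have hlpos : 0 < x l := by
    by_cases hml : m = l
    · rw [← hml, hm]
      exact one_pos
    · exact hpos l m (hl m hml) (hm ▸ one_pos)
  -- Positivity spreads along edges from the maximal entry to the dominating vertex and from there
  -- everywhere, so every new edge adds a positive amount to the form.
  have hall : ∀ v, 0 < x v := by
    intro v
    by_cases hv : v = l
    · exact hv ▸ hlpos
    · exact hpos v l (hl v hv).symm hlpos
  have hne : ∃ a b, G'.Adj a b ∧ ¬ G.Adj a b := by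
    by_contra hcon
    push Not at hcon
    exact h.not_ge fun a b hab => hcon a b hab
  obtain ⟨a, b, hab', hab⟩ := hne
  have h1 := adjForm_add_le hx (fun u v _ _ huv => h.le huv) hab hab'
  have h2 : adjForm G x = ρ * ∑ v, x v ^ 2 := by
    rw [adjForm, Finset.mul_sum]
    refine Finset.sum_congr rfl fun v _ => ?_
    rw [heig]
    ring
  have h3 := hmax x
  have h4 : 0 < ∑ v, x v ^ 2 := Finset.sum_pos (fun v _ => pow_pos (hall v) 2) ⟨l, Finset.mem_univ l⟩
  have h5 := mul_pos (hall a) (hall b)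
  have h6 : ρ * ∑ v, x v ^ 2 < ρ' * ∑ v, x v ^ 2 := by linarith
  have h7 := lt_of_mul_lt_mul_right h6 h4.le
  rw [hG, hG']
  exact (ENNReal.ofReal_lt_ofReal_iff (hρ.trans_lt h7)).2 h7

/-- A lower bound for the spectral radius of a graph containing a book. -/
lemma card_mul_le_sq_of_dominating {G : SimpleGraph V} {L : Finset V} (hL : L.Nonempty)
    (hLV : L.card < Fintype.card V) (hG : ∀ l ∈ L, ∀ v, v ≠ l → G.Adj l v) {ρ : ℝ}
    (hmax : ∀ y : V → ℝ, adjForm G y ≤ ρ * ∑ v, y v ^ 2) :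
    (L.card : ℝ) * (Fintype.card V - L.card) ≤ ρ ^ 2 := by
  set s : ℝ := (L.card : ℝ) with hs
  set m : ℝ := (Fintype.card V : ℝ) - L.card with hm
  have hs0 : 0 < s := Nat.cast_pos.2 hL.card_pos
  have hm0 : 0 < m := sub_pos.2 (by exact_mod_cast hLV)
  set a := Real.sqrt s with ha
  set b := Real.sqrt m with hb
  have ha2 : a ^ 2 = s := Real.sq_sqrt hs0.le
  have hb2 : b ^ 2 = m := Real.sq_sqrt hm0.le
  have ha0 : 0 < a := Real.sqrt_pos.2 hs0
  have hb0 : 0 < b := Real.sqrt_pos.2 hm0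
  have hmc : ((Lᶜ : Finset V).card : ℝ) = m := by
    rw [Finset.card_compl, Nat.cast_sub hLV.le]
  -- This is the Perron vector of the complete bipartite graph between L and its complement, with
  -- eigenvalue √(s m).
  let y : V → ℝ := fun v => if v ∈ L then b else a
  have hy0 : ∀ v, 0 ≤ y v := fun v => by
    by_cases hv : v ∈ L <;> simp [y, hv, ha0.le, hb0.le]
  have h1 : ∀ v, (if v ∈ L then b * (m * a) else a * (s * b)) ≤ y v * nbrSum G y v := by
    intro v
    by_cases hv : v ∈ L
    · have h2 := sum_le_nbrSum G hy0 (v := v) (T := Lᶜ) fun u hu =>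
        hG v hv u fun h => (Finset.mem_compl.1 hu) (h ▸ hv)
      have h3 : ∑ u ∈ Lᶜ, y u = m * a := by
        rw [Finset.sum_congr rfl fun u hu => if_neg (Finset.mem_compl.1 hu), Finset.sum_const,
          nsmul_eq_mul, hmc]
      rw [h3] at h2
      simp only [y, hv, if_true]
      exact mul_le_mul_of_nonneg_left h2 hb0.le
    · have h2 := sum_le_nbrSum G hy0 (v := v) (T := L) fun u hu =>
        (hG u hu v fun h => hv (h ▸ hu)).symm
      have h3 : ∑ u ∈ L, y u = s * b := by
        rw [Finset.sum_congr rfl fun u hu => if_pos hu, Finset.sum_const, nsmul_eq_mul]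
      rw [h3] at h2
      simp only [y, hv, if_false]
      exact mul_le_mul_of_nonneg_left h2 ha0.le
  have hsplit : ∀ c d : ℝ, ∑ v : V, (if v ∈ L then c else d) = s * c + m * d := by
    intro c d
    have f1 : Finset.univ.filter (fun v => v ∈ L) = L := by ext v; simp
    have f2 : Finset.univ.filter (fun v => v ∉ L) = Lᶜ := by ext v; simp
    rw [Finset.sum_ite, Finset.sum_const, Finset.sum_const, nsmul_eq_mul, nsmul_eq_mul, f1, f2, hmc]
  have h4 := (Finset.sum_le_sum fun v _ => h1 v).trans (hmax y)
  have h5 : ∑ v, y v ^ 2 = s * b ^ 2 + m * a ^ 2 := by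
    rw [← hsplit]
    refine Finset.sum_congr rfl fun v _ => ?_
    by_cases hv : v ∈ L <;> simp [y, hv]
  rw [hsplit, h5, ha2, hb2] at h4
  have h6 : a * b ≤ ρ := by
    have : (2 * (s * m)) * (a * b) ≤ (2 * (s * m)) * ρ := by linarith
    exact le_of_mul_le_mul_left this (by positivity)
  calc s * m = (a * b) ^ 2 := by rw [mul_pow, ha2, hb2]
    _ ≤ ρ ^ 2 := pow_le_pow_left₀ (by positivity) h6 2

end Gain

/-! ### Large entries of the Perron vector of a sparse graph -/

section Structure
open scoped Classical

variable {V : Type*} [Fintype V]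

/-- The neighbours of a vertex, as a finset. -/
noncomputable def nbrs (G : SimpleGraph V) (v : V) : Finset V := Finset.univ.filter (G.Adj v)

lemma mem_nbrs {G : SimpleGraph V} {u v : V} : u ∈ nbrs G v ↔ G.Adj v u := by simp [nbrs]

/-- A sparse graph together with a nonnegative eigenvector whose largest entry is `1`. -/
structure SparsePerron (G : SimpleGraph V) (k ρ : ℝ) (x : V → ℝ) : Prop where
  one_le : 1 ≤ k
  sparse : ∀ X : Finset V, (adjPairs G X : ℝ) ≤ k * X.card
  pos : 0 < ρ
  nonneg : ∀ v, 0 ≤ x v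
  le_one : ∀ v, x v ≤ 1
  exists_one : ∃ v, x v = 1
  eig : ∀ v, nbrSum G x v = ρ * x v

namespace SparsePerron

variable {G : SimpleGraph V} {k ρ : ℝ} {x : V → ℝ}

lemma sum_card_nbrs_le (h : SparsePerron G k ρ x) :
    ∑ v, ((nbrs G v).card : ℝ) ≤ k * Fintype.card V := by
  have := h.sparse Finset.univ
  rw [adjPairs, Finset.card_univ] at this
  exact_mod_cast this

lemma sum_card_filter_le (h : SparsePerron G k ρ x) (N A : Finset V) :
    ∑ u ∈ N, ((A.filter (G.Adj u)).card : ℝ) ≤ k * (N.card + A.card) := by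
  have h1 : ∑ u ∈ N, (A.filter (G.Adj u)).card ≤ adjPairs G (N ∪ A) := by
    rw [adjPairs]
    refine (Finset.sum_le_sum fun u _ => Finset.card_le_card
      (Finset.filter_subset_filter _ Finset.subset_union_right)).trans
      (Finset.sum_le_sum_of_subset Finset.subset_union_left)
  calc ∑ u ∈ N, ((A.filter (G.Adj u)).card : ℝ) ≤ adjPairs G (N ∪ A) := by exact_mod_cast h1
    _ ≤ k * (N ∪ A).card := h.sparse _
    _ ≤ k * (N.card + A.card) := mul_le_mul_of_nonneg_left
        (by exact_mod_cast Finset.card_union_le N A) (zero_le_one.trans h.one_le)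

lemma sum_nbrs (h : SparsePerron G k ρ x) (v : V) : ∑ u ∈ nbrs G v, x u = ρ * x v := by
  rw [← h.eig, nbrSum_eq_sum_filter, nbrs]

lemma le_card_nbrs (h : SparsePerron G k ρ x) (v : V) : ρ * x v ≤ (nbrs G v).card := by
  rw [← h.sum_nbrs]
  calc ∑ u ∈ nbrs G v, x u ≤ ∑ u ∈ nbrs G v, (1 : ℝ) := Finset.sum_le_sum fun u _ => h.le_one u
    _ = (nbrs G v).card := by simp

/-- Two steps of the eigenvalue equation, with the small entries split off. -/
lemma sq_mul_le (h : SparsePerron G k ρ x) {ε : ℝ} (hε : 0 ≤ ε) {A : Finset V}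
    (hA : ∀ z ∉ A, x z ≤ ε) (v : V) :
    ρ ^ 2 * x v ≤ ∑ u ∈ nbrs G v, ∑ z ∈ A.filter (G.Adj u), x z + ε * (k * Fintype.card V) := by
  have h1 : ∀ u, ρ * x u ≤ ∑ z ∈ A.filter (G.Adj u), x z + ε * (nbrs G u).card := by
    intro u
    rw [← h.sum_nbrs, ← Finset.sum_filter_add_sum_filter_not (nbrs G u) (· ∈ A)]
    have e : (nbrs G u).filter (· ∈ A) = A.filter (G.Adj u) := by
      ext z
      simp [mem_nbrs, and_comm]
    rw [e]
    refine add_le_add_right ?_ _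
    calc ∑ z ∈ (nbrs G u).filter (· ∉ A), x z ≤ ∑ z ∈ (nbrs G u).filter (· ∉ A), ε :=
          Finset.sum_le_sum fun z hz => hA z (Finset.mem_filter.1 hz).2
      _ = ((nbrs G u).filter (· ∉ A)).card * ε := by rw [Finset.sum_const, nsmul_eq_mul]
      _ ≤ (nbrs G u).card * ε := mul_le_mul_of_nonneg_right
          (by exact_mod_cast Finset.card_filter_le _ _) hε
      _ = ε * (nbrs G u).card := mul_comm _ _
  calc ρ ^ 2 * x v = ∑ u ∈ nbrs G v, ρ * x u := by
        rw [← Finset.mul_sum, h.sum_nbrs]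
        ring
    _ ≤ ∑ u ∈ nbrs G v, (∑ z ∈ A.filter (G.Adj u), x z + ε * (nbrs G u).card) :=
        Finset.sum_le_sum fun u _ => h1 u
    _ = ∑ u ∈ nbrs G v, ∑ z ∈ A.filter (G.Adj u), x z + ε * ∑ u ∈ nbrs G v, ((nbrs G u).card : ℝ) := by
        rw [Finset.sum_add_distrib, Finset.mul_sum]
    _ ≤ _ := by
        refine add_le_add_right (mul_le_mul_of_nonneg_left (le_trans ?_ h.sum_card_nbrs_le) hε) _
        exact Finset.sum_le_sum_of_subset_of_nonneg (Finset.subset_univ _)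
          fun _ _ _ => Nat.cast_nonneg _

/-- Vertices with a large entry have linear degree. -/
lemma mul_half_le (h : SparsePerron G k ρ x) {ε : ℝ} (hε : 0 < ε) (hρ : k / ε ^ 2 ≤ ρ)
    (hρn : (Fintype.card V : ℝ) / 2 ≤ ρ ^ 2) (v : V) :
    x v * (Fintype.card V / 2) ≤ k * (nbrs G v).card + 2 * k * ε * Fintype.card V := by
  have hk : 0 < k := zero_lt_one.trans_le h.one_le
  set A : Finset V := Finset.univ.filter fun z => ε ≤ x z with hA
  have h1 : (A.card : ℝ) * (ρ * ε) ≤ k * Fintype.card V := by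
    calc (A.card : ℝ) * (ρ * ε) = ∑ z ∈ A, ρ * ε := by rw [Finset.sum_const, nsmul_eq_mul]
      _ ≤ ∑ z ∈ A, ((nbrs G z).card : ℝ) := Finset.sum_le_sum fun z hz =>
          (mul_le_mul_of_nonneg_left (Finset.mem_filter.1 hz).2 h.pos.le).trans (h.le_card_nbrs z)
      _ ≤ ∑ z, ((nbrs G z).card : ℝ) := Finset.sum_le_sum_of_subset_of_nonneg
          (Finset.subset_univ _) fun _ _ _ => Nat.cast_nonneg _
      _ ≤ _ := h.sum_card_nbrs_le
  -- A vertex of entry at least ε has degree at least ρε, while the degrees sum to at most k times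
  -- the order. The bound on ρ then limits their number.
  have h2 : (A.card : ℝ) ≤ ε * Fintype.card V := by
    have h3 : k / ε ≤ ρ * ε := by
      have := mul_le_mul_of_nonneg_right hρ hε.le
      have e : k / ε ^ 2 * ε = k / ε := by field_simp
      rwa [e] at this
    have h4 : (A.card : ℝ) * (k / ε) ≤ k * Fintype.card V :=
      (mul_le_mul_of_nonneg_left h3 (Nat.cast_nonneg _)).trans h1
    have h5 : k * (A.card : ℝ) ≤ k * (ε * Fintype.card V) := by
      have := mul_le_mul_of_nonneg_right h4 hε.le
      have e : (A.card : ℝ) * (k / ε) * ε = k * A.card := by field_simp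
      rw [e] at this
      linarith
    exact le_of_mul_le_mul_left h5 hk
  have h6 := h.sq_mul_le hε.le (A := A) (fun z hz => by
    by_contra hlt
    exact hz (by simpa [hA] using (not_le.1 hlt).le)) v
  have h7 : ∑ u ∈ nbrs G v, ∑ z ∈ A.filter (G.Adj u), x z ≤ k * ((nbrs G v).card + A.card) := by
    refine le_trans (Finset.sum_le_sum fun u _ => ?_) (h.sum_card_filter_le (nbrs G v) A)
    calc ∑ z ∈ A.filter (G.Adj u), x z ≤ ∑ z ∈ A.filter (G.Adj u), (1 : ℝ) :=
          Finset.sum_le_sum fun z _ => h.le_one z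
      _ = (A.filter (G.Adj u)).card := by simp
  have h8 := mul_le_mul_of_nonneg_left h2 hk.le
  have h9 := mul_le_mul_of_nonneg_left hρn (h.nonneg v)
  nlinarith

/-- There are boundedly many vertices with a large entry. -/
lemma card_large_le (h : SparsePerron G k ρ x) [Nonempty V] {η : ℝ} (hη : 0 < η)
    (hρ : k / (η / (8 * k)) ^ 2 ≤ ρ) (hρn : (Fintype.card V : ℝ) / 2 ≤ ρ ^ 2) :
    ((Finset.univ.filter fun z => η ≤ x z).card : ℝ) ≤ 4 * k ^ 2 / η := by
  have hk : 0 < k := zero_lt_one.trans_le h.one_le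
  have hn : (0 : ℝ) < Fintype.card V := by exact_mod_cast Fintype.card_pos
  set A : Finset V := Finset.univ.filter fun z => η ≤ x z with hA
  -- With ε = η / (8k) the error term of `mul_half_le` is half of the main term, so the degree stays
  -- linear. The bounded degree sum then permits only boundedly many such vertices.
  have h1 : ∀ z ∈ A, η * Fintype.card V / (4 * k) ≤ (nbrs G z).card := by
    intro z hz
    have h2 := h.mul_half_le (by positivity) hρ hρn z
    have h3 : η * (Fintype.card V / 2) ≤ x z * (Fintype.card V / 2) :=
      mul_le_mul_of_nonneg_right (Finset.mem_filter.1 hz).2 (by positivity)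
    have e : 2 * k * (η / (8 * k)) * Fintype.card V = η * Fintype.card V / 4 := by
      field_simp
      ring
    rw [e] at h2
    rw [div_le_iff₀ (by positivity)]
    linarith
  have h4 : (A.card : ℝ) * (η * Fintype.card V / (4 * k)) ≤ k * Fintype.card V := by
    calc (A.card : ℝ) * (η * Fintype.card V / (4 * k))
        = ∑ z ∈ A, η * Fintype.card V / (4 * k) := by rw [Finset.sum_const, nsmul_eq_mul]
      _ ≤ ∑ z ∈ A, ((nbrs G z).card : ℝ) := Finset.sum_le_sum h1
      _ ≤ ∑ z, ((nbrs G z).card : ℝ) := Finset.sum_le_sum_of_subset_of_nonneg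
          (Finset.subset_univ _) fun _ _ _ => Nat.cast_nonneg _
      _ ≤ _ := h.sum_card_nbrs_le
  have e : (A.card : ℝ) * (η * Fintype.card V / (4 * k))
      = (A.card * η / (4 * k)) * Fintype.card V := by ring
  rw [e] at h4
  have h5 := le_of_mul_le_mul_right h4 hn
  rw [div_le_iff₀ (by positivity)] at h5
  rw [le_div_iff₀ hη]
  linarith

end SparsePerron

/-- If any `γ + 1` vertices have fewer than `r` common neighbours, then few vertices have more than
`γ` neighbours in a given set. -/
lemma card_many_neighbors_le {G : SimpleGraph V} {r γ : ℕ}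
    (hK : ∀ M : Finset V, M.card = γ + 1 →
      (Finset.univ.filter fun u => ∀ m ∈ M, G.Adj m u).card < r) (A : Finset V) :
    (Finset.univ.filter fun u => γ + 1 ≤ (A.filter (G.Adj u)).card).card ≤ 2 ^ A.card * r := by
  -- Such a vertex is a common neighbour of some γ + 1 elements of A, and A has `2 ^ A.card`
  -- subsets.
  have h1 : (Finset.univ.filter fun u => γ + 1 ≤ (A.filter (G.Adj u)).card) ⊆
      A.powerset.biUnion fun M => if M.card = γ + 1 then
        Finset.univ.filter fun u => ∀ m ∈ M, G.Adj m u else ∅ := by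
    intro u hu
    obtain ⟨M, hM, hMc⟩ := Finset.exists_subset_card_eq (Finset.mem_filter.1 hu).2
    refine Finset.mem_biUnion.2 ⟨M, Finset.mem_powerset.2 (hM.trans (Finset.filter_subset _ _)), ?_⟩
    rw [if_pos hMc, Finset.mem_filter]
    exact ⟨Finset.mem_univ _, fun m hm => (Finset.mem_filter.1 (hM hm)).2.symm⟩
  refine (Finset.card_le_card h1).trans ?_
  rw [← Finset.card_powerset]
  refine Finset.card_biUnion_le_card_mul _ _ _ fun M _ => ?_
  split_ifs with hM
  · exact (hK M hM).le
  · simp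

end Structure

/-! ### The γ vertices of entry close to one -/

section Core
open scoped Classical

variable {V : Type*} [Fintype V]

/-- The vertices with entry close to `1` form a set of `γ` vertices with almost all vertices as
common neighbours, and all other entries are small. -/
lemma SparsePerron.exists_core {G : SimpleGraph V} {k ρ : ℝ} {x : V → ℝ}
    (h : SparsePerron G k ρ x) {r γ a : ℕ} (hγ : 1 ≤ γ)
    (hK : ∀ M : Finset V, M.card = γ + 1 →
      (Finset.univ.filter fun u => ∀ m ∈ M, G.Adj m u).card < r) {δ η θ κ n : ℝ}
    (hn : (Fintype.card V : ℝ) = n) (hn0 : 0 < n) (hδ : 0 < δ) (hδγ : (γ + 1) * (2 * δ) ≤ 1 / 2)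
    (hη : 0 < η) (hηδ : η * (k + 2) ≤ δ) (hηθ : η * (k + 2) ≤ δ * θ) (hθ1 : θ < 1)
    (hθκ : 8 * k * θ ≤ κ) (hηκ : 2 * η ≤ κ) (hρ : k / (η / (8 * k)) ^ 2 ≤ ρ)
    (hρn : n / 2 ≤ ρ ^ 2) (hργ : (γ : ℝ) * (n - γ) ≤ ρ ^ 2) (hγn : (γ : ℝ) ^ 2 ≤ η * n)
    (ha : 4 * k ^ 2 / η ≤ a) (han : (2 : ℝ) ^ a * r * a ≤ η * n) (hrn : 2 * (r : ℝ) ≤ n)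
    (hrκ : 8 * k * r ≤ κ * n) :
    ∃ L : Finset V, L.card = γ ∧ (∀ l ∈ L, 1 - δ ≤ x l) ∧ (∀ w ∉ L, x w ≤ κ) ∧
      ((Finset.univ.filter fun u => ¬ ∀ l ∈ L, G.Adj l u).card : ℝ) ≤ θ * n := by
  have hk : 0 < k := zero_lt_one.trans_le h.one_le
  obtain ⟨v₀, hv₀⟩ := h.exists_one
  have : Nonempty V := ⟨v₀⟩
  have hγ1 : (1 : ℝ) ≤ γ := by exact_mod_cast hγ
  have hδ1 : δ ≤ 1 / 8 := by nlinarith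
  have hηδ' : η ≤ δ := by nlinarith
  subst hn
  set A : Finset V := Finset.univ.filter fun z => η ≤ x z with hA
  set Bad : Finset V := Finset.univ.filter fun u => γ + 1 ≤ (A.filter (G.Adj u)).card with hBad
  set s : V → ℝ := fun u => ∑ z ∈ A.filter (G.Adj u), x z with hs
  have hs_card : ∀ u, s u ≤ (A.filter (G.Adj u)).card := fun u => by
    calc s u ≤ ∑ z ∈ A.filter (G.Adj u), (1 : ℝ) := Finset.sum_le_sum fun z _ => h.le_one z
      _ = (A.filter (G.Adj u)).card := by simp
  have hcard : ∀ u, u ∉ Bad → (A.filter (G.Adj u)).card ≤ γ := fun u hu => by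
    by_contra hc
    exact hu (Finset.mem_filter.2 ⟨Finset.mem_univ _, not_le.1 hc⟩)
  have hsγ : ∀ u, u ∉ Bad → s u ≤ γ := fun u hu =>
    (hs_card u).trans (by exact_mod_cast hcard u hu)
  have hAa : A.card ≤ a := by
    have := (h.card_large_le hη hρ hρn).trans ha
    exact_mod_cast this
  have hBadA : (Bad.card : ℝ) * A.card ≤ η * Fintype.card V := by
    refine le_trans ?_ han
    have h1 : Bad.card * A.card ≤ 2 ^ a * r * a := Nat.mul_le_mul
      ((card_many_neighbors_le hK A).trans
        (Nat.mul_le_mul_right _ (Nat.pow_le_pow_right two_pos hAa))) hAa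
    exact_mod_cast h1
  -- The error η(k + 2)n collects ηkn from the entries below η, ηn from the boundedly many vertices
  -- of `Bad`, and ηn from replacing γ(n - γ) by γn.
  have hmain : ∀ v, γ * Fintype.card V * x v ≤
      ∑ u ∈ (nbrs G v).filter (· ∉ Bad), s u + η * (k + 2) * Fintype.card V := by
    intro v
    have h1 := h.sq_mul_le hη.le (A := A) (fun z hz => by
      by_contra hlt
      exact hz (by simpa [hA] using (not_le.1 hlt).le)) v
    rw [← Finset.sum_filter_add_sum_filter_not (nbrs G v) (· ∈ Bad)] at h1
    have h2 : ∑ u ∈ (nbrs G v).filter (· ∈ Bad), s u ≤ Bad.card * A.card := by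
      calc ∑ u ∈ (nbrs G v).filter (· ∈ Bad), s u
          ≤ ∑ u ∈ (nbrs G v).filter (· ∈ Bad), (A.card : ℝ) := Finset.sum_le_sum fun u _ =>
            (hs_card u).trans (by exact_mod_cast Finset.card_filter_le _ _)
        _ = ((nbrs G v).filter (· ∈ Bad)).card * A.card := by rw [Finset.sum_const, nsmul_eq_mul]
        _ ≤ Bad.card * A.card := mul_le_mul_of_nonneg_right
            (by exact_mod_cast Finset.card_le_card fun u hu => (Finset.mem_filter.1 hu).2)
            (Nat.cast_nonneg _)
    have h3 := mul_le_mul_of_nonneg_right hργ (h.nonneg v)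
    have h4 : (γ : ℝ) ^ 2 * x v ≤ γ ^ 2 := mul_le_of_le_one_right (sq_nonneg _) (h.le_one v)
    linarith
  have hdeg : ∀ v, 1 - δ ≤ x v → (1 - 2 * δ) * Fintype.card V ≤ (nbrs G v).card := by
    intro v hv
    have h1 : ∑ u ∈ (nbrs G v).filter (· ∉ Bad), s u ≤ γ * (nbrs G v).card := by
      calc ∑ u ∈ (nbrs G v).filter (· ∉ Bad), s u ≤ ∑ u ∈ (nbrs G v).filter (· ∉ Bad), (γ : ℝ) :=
            Finset.sum_le_sum fun u hu => hsγ u (Finset.mem_filter.1 hu).2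
        _ = γ * ((nbrs G v).filter (· ∉ Bad)).card := by
            rw [Finset.sum_const, nsmul_eq_mul, mul_comm]
        _ ≤ γ * (nbrs G v).card := mul_le_mul_of_nonneg_left
            (by exact_mod_cast Finset.card_filter_le _ _) (Nat.cast_nonneg _)
    have h2 := hmain v
    have h3 : (γ : ℝ) * Fintype.card V * (1 - δ) ≤ γ * Fintype.card V * x v :=
      mul_le_mul_of_nonneg_left hv (by positivity)
    have h4 : η * (k + 2) * Fintype.card V ≤ γ * (δ * Fintype.card V) := by
      have e1 := mul_le_mul_of_nonneg_right hηδ hn0.le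
      have e2 : δ * (Fintype.card V : ℝ) ≤ γ * (δ * Fintype.card V) :=
        le_mul_of_one_le_left (by positivity) hγ1
      linarith
    have h5 : (γ : ℝ) * ((1 - 2 * δ) * Fintype.card V) ≤ γ * (nbrs G v).card := by linarith
    exact le_of_mul_le_mul_left h5 (by linarith)
  set L : Finset V := Finset.univ.filter fun z => 1 - δ ≤ x z with hL
  have hLx : ∀ l ∈ L, 1 - δ ≤ x l := fun l hl => (Finset.mem_filter.1 hl).2
  -- By `hdeg`, γ + 1 vertices of entry at least 1 - δ would miss at most half of the vertices
  -- between them, leaving at least r common neighbours.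
  have hLcard : L.card ≤ γ := by
    by_contra hc
    obtain ⟨M, hM, hMc⟩ := Finset.exists_subset_card_eq (not_le.1 hc)
    have h1 : (Finset.univ.filter fun u => ¬ ∀ m ∈ M, G.Adj m u) ⊆
        M.biUnion fun m => (nbrs G m)ᶜ := by
      intro u hu
      have := (Finset.mem_filter.1 hu).2
      push Not at this
      obtain ⟨m, hm, hmu⟩ := this
      exact Finset.mem_biUnion.2 ⟨m, hm, Finset.mem_compl.2 fun hh => hmu (mem_nbrs.1 hh)⟩
    have h2 : ((Finset.univ.filter fun u => ¬ ∀ m ∈ M, G.Adj m u).card : ℝ) ≤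
        (γ + 1) * (2 * δ * Fintype.card V) := by
      calc ((Finset.univ.filter fun u => ¬ ∀ m ∈ M, G.Adj m u).card : ℝ)
          ≤ ∑ m ∈ M, (((nbrs G m)ᶜ).card : ℝ) := by
            exact_mod_cast (Finset.card_le_card h1).trans Finset.card_biUnion_le
        _ ≤ ∑ m ∈ M, 2 * δ * Fintype.card V := by
            refine Finset.sum_le_sum fun m hm => ?_
            rw [Finset.card_compl, Nat.cast_sub (Finset.card_le_univ _)]
            have := hdeg m (hLx m (hM hm))
            linarith
        _ = (γ + 1) * (2 * δ * Fintype.card V) := by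
            rw [Finset.sum_const, nsmul_eq_mul, hMc]
            push_cast
            ring
    have h3 := Finset.card_filter_add_card_filter_not (s := (Finset.univ : Finset V))
      (fun u => ∀ m ∈ M, G.Adj m u)
    rw [Finset.card_univ] at h3
    have h4 : ((Finset.univ.filter fun u => ∀ m ∈ M, G.Adj m u).card : ℝ) < r := by
      exact_mod_cast hK M hMc
    have h5 : ((Finset.univ.filter fun u => ∀ m ∈ M, G.Adj m u).card : ℝ) +
        (Finset.univ.filter fun u => ¬ ∀ m ∈ M, G.Adj m u).card = Fintype.card V := by
      exact_mod_cast h3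
    have h6 := mul_le_mul_of_nonneg_right hδγ hn0.le
    linarith
  set Good : Finset V := Finset.univ.filter fun u => u ∉ Bad ∧ γ - δ ≤ s u with hGood
  -- A sum of at most γ terms, each at most 1, that reaches γ - δ has exactly γ terms, each at least
  -- 1 - δ.
  have hgood : ∀ u ∈ Good, A.filter (G.Adj u) = L ∧ L.card = γ := by
    intro u hu
    obtain ⟨hu1, hu2⟩ := (Finset.mem_filter.1 hu).2
    set T := A.filter (G.Adj u) with hT
    have hTγ : T.card ≤ γ := hcard u hu1
    have hTγ' : γ ≤ T.card := by
      by_contra hc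
      have h1 : (T.card : ℝ) + 1 ≤ γ := by exact_mod_cast not_le.1 hc
      have := hs_card u
      linarith
    have hTL : T ⊆ L := by
      intro z hz
      have h1 : s u = x z + ∑ z ∈ T.erase z, x z := (Finset.add_sum_erase T x hz).symm
      have h2 : ∑ z ∈ T.erase z, x z ≤ (T.card : ℝ) - 1 := by
        calc ∑ z ∈ T.erase z, x z ≤ ∑ z ∈ T.erase z, (1 : ℝ) :=
              Finset.sum_le_sum fun z _ => h.le_one z
          _ = (T.erase z).card := by simp
          _ = (T.card : ℝ) - 1 := by
              rw [← Finset.card_erase_add_one hz]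
              push_cast
              ring
      have h3 : (T.card : ℝ) ≤ γ := by exact_mod_cast hTγ
      refine Finset.mem_filter.2 ⟨Finset.mem_univ _, ?_⟩
      linarith
    have e := Finset.eq_of_subset_of_card_le hTL (hLcard.trans hTγ')
    exact ⟨e, le_antisymm hLcard (e ▸ hTγ')⟩
  -- At the vertex of entry 1 the bound `hmain` is almost tight, and each vertex that is not good
  -- costs at least δ.
  have hGoodcard : (Fintype.card V : ℝ) - Good.card ≤ θ * Fintype.card V := by
    have h1 := hmain v₀
    have h2 : ∑ u ∈ (nbrs G v₀).filter (· ∉ Bad), s u ≤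
        (γ - δ) * Fintype.card V + δ * Good.card := by
      calc ∑ u ∈ (nbrs G v₀).filter (· ∉ Bad), s u
          ≤ ∑ u ∈ (nbrs G v₀).filter (· ∉ Bad), ((γ - δ) + if u ∈ Good then δ else 0) := by
            refine Finset.sum_le_sum fun u hu => ?_
            have hu' := (Finset.mem_filter.1 hu).2
            by_cases hg : u ∈ Good
            · rw [if_pos hg]
              have := hsγ u hu'
              linarith
            · rw [if_neg hg, add_zero]
              by_contra hlt
              exact hg (Finset.mem_filter.2 ⟨Finset.mem_univ _, hu', (not_le.1 hlt).le⟩)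
        _ ≤ ∑ u : V, ((γ - δ) + if u ∈ Good then δ else 0) := by
            refine Finset.sum_le_sum_of_subset_of_nonneg (Finset.subset_univ _) fun u _ _ => ?_
            have : (0 : ℝ) ≤ if u ∈ Good then δ else 0 := by split_ifs <;> linarith
            linarith
        _ = (γ - δ) * Fintype.card V + δ * Good.card := by
            rw [Finset.sum_add_distrib, Finset.sum_const, Finset.sum_ite_mem, Finset.univ_inter,
              Finset.sum_const, nsmul_eq_mul, nsmul_eq_mul, Finset.card_univ]
            ring
    rw [hv₀, mul_one] at h1
    have h3 := mul_le_mul_of_nonneg_right hηθ hn0.le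
    have h4 : δ * ((Fintype.card V : ℝ) - Good.card) ≤ δ * (θ * Fintype.card V) := by linarith
    exact le_of_mul_le_mul_left h4 hδ
  have hLγ : L.card = γ := by
    have : (0 : ℝ) < Good.card := by nlinarith
    obtain ⟨u, hu⟩ := Finset.card_pos.1 (by exact_mod_cast this)
    exact (hgood u hu).2
  have hmiss : ((Finset.univ.filter fun u => ¬ ∀ l ∈ L, G.Adj l u).card : ℝ)
      ≤ θ * Fintype.card V := by
    refine le_trans ?_ hGoodcard
    have h1 : (Finset.univ.filter fun u => ¬ ∀ l ∈ L, G.Adj l u) ⊆ Goodᶜ := by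
      intro u hu
      refine Finset.mem_compl.2 fun hg => (Finset.mem_filter.1 hu).2 fun l hl => ?_
      rw [← (hgood u hg).1] at hl
      exact (Finset.mem_filter.1 hl).2.symm
    rw [← Nat.cast_sub (Finset.card_le_univ _), ← Finset.card_compl]
    exact_mod_cast Finset.card_le_card h1
  refine ⟨L, hLγ, hLx, fun w hw => ?_, hmiss⟩
  -- A neighbour of w either is common to w and L, which happens fewer than r times, or misses L
  -- somewhere. So w has small degree, hence a small entry by `mul_half_le`.
  have h1 : nbrs G w ⊆ (Finset.univ.filter fun u => ∀ m ∈ insert w L, G.Adj m u) ∪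
      Finset.univ.filter fun u => ¬ ∀ l ∈ L, G.Adj l u := by
    intro u hu
    by_cases hc : ∀ l ∈ L, G.Adj l u
    · refine Finset.mem_union_left _ (Finset.mem_filter.2 ⟨Finset.mem_univ _, fun m hm => ?_⟩)
      rcases Finset.mem_insert.1 hm with rfl | hm
      exacts [mem_nbrs.1 hu, hc m hm]
    · exact Finset.mem_union_right _ (Finset.mem_filter.2 ⟨Finset.mem_univ _, hc⟩)
  have h2 : ((nbrs G w).card : ℝ) ≤ r + θ * Fintype.card V := by
    have h3 := (Finset.card_le_card h1).trans (Finset.card_union_le _ _)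
    have h4 := hK (insert w L) (by rw [Finset.card_insert_of_notMem hw, hLγ])
    calc ((nbrs G w).card : ℝ) ≤ r + (Finset.univ.filter fun u => ¬ ∀ l ∈ L, G.Adj l u).card := by
          exact_mod_cast h3.trans (Nat.add_le_add_right h4.le _)
      _ ≤ _ := add_le_add_right hmiss _
  have h3 := h.mul_half_le (by positivity) hρ hρn w
  have e : 2 * k * (η / (8 * k)) * Fintype.card V = η * Fintype.card V / 4 := by
    field_simp
    ring
  rw [e] at h3
  have h4 := mul_le_mul_of_nonneg_left h2 hk.le
  have h5 := mul_le_mul_of_nonneg_right hθκ hn0.le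
  have h6 := mul_le_mul_of_nonneg_right hηκ hn0.le
  have h7 : x w * Fintype.card V ≤ κ * Fintype.card V := by
    have : 0 ≤ κ * (Fintype.card V : ℝ) := by
      have : 0 < η * (Fintype.card V : ℝ) := mul_pos hη hn0
      linarith
    linarith
  exact le_of_mul_le_mul_right h7 hn0

end Core

/-! ### Reattaching vertices to make the core dominating -/

section Dominating
open scoped Classical

variable {V : Type*}

/-- The graph obtained from `G` by completing `L` to a clique and by making the vertices of `J`
adjacent exactly to the vertices of `L`. -/
def pendantGraph (G : SimpleGraph V) (L J : Finset V) : SimpleGraph V where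
  Adj u v := u ≠ v ∧ ((u ∈ L ∧ v ∈ L) ∨ (u ∈ L ∧ v ∈ J) ∨ (u ∈ J ∧ v ∈ L) ∨
    (u ∉ J ∧ v ∉ J ∧ G.Adj u v))
  symm.symm u v h := ⟨h.1.symm, by
    have := G.adj_comm u v
    tauto⟩
  loopless.irrefl _ h := h.1 rfl

lemma pendantGraph_adj_iff {G : SimpleGraph V} {L J : Finset V} (hLJ : Disjoint L J) {j : V}
    (hj : j ∈ J) (v : V) : (pendantGraph G L J).Adj j v ↔ v ∈ L := by
  have hjL : j ∉ L := Finset.disjoint_right.1 hLJ hj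
  simp only [pendantGraph, hj, hjL, not_true, false_and, or_false, false_or, true_and]
  exact ⟨fun h => h.2, fun h => ⟨fun e => hjL (e ▸ h), h⟩⟩

lemma pendantGraph_not_isMinor {r : ℕ} {F : SimpleGraph (Fin r)} {G : SimpleGraph V}
    (hG : ¬ IsMinor F G) {L I J : Finset V} (hLJ : Disjoint L J) (hIJ : I ⊆ J) (hI : r ≤ I.card)
    (hIL : ∀ j ∈ I, ∀ l ∈ L, G.Adj l j) : ¬ IsMinor F (pendantGraph G L J) := by
  obtain ⟨I', hI', hc⟩ := Finset.exists_subset_card_eq hI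
  let e := (Finset.equivFinOfCardEq hc).symm
  refine fun h => hG (h.of_pendant (L := L) (J := J) (by exact_mod_cast hLJ)
    (fun i => (e i : V)) (fun i j hij => e.injective (Subtype.ext hij))
    (fun i => hIJ (hI' (e i).2)) (fun i l hl => hIL _ (hI' (e i).2) l hl)
    (fun u hu v huv => (pendantGraph_adj_iff hLJ hu v).1 huv) fun u v hu hv hL huv => ?_)
  obtain ⟨-, h | h | h | h⟩ := huv
  · exact absurd h hL
  · exact absurd h.2 hv
  · exact absurd h.1 hu
  · exact h.2.2

variable [Fintype V]

/-- Take r low-degree vertices I complete to L and reattach them to exactly L, at a cost of at most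
1/16. If L misses an inner edge, adding it gains at least 1/2. If an outer vertex w misses part of
L, reattaching w as well gains at least 3/16. Either contradicts `sum_sq_sub_sq_add_le_zero`. -/
lemma SparsePerron.dominating {G : SimpleGraph V} {k ρ : ℝ} {x : V → ℝ}
    (h : SparsePerron G k ρ x) {r : ℕ} {F : SimpleGraph (Fin r)} (hF : ¬ IsMinor F G)
    (hmax : ∀ G' : SimpleGraph V, ¬ IsMinor F G' →
      ∀ y : V → ℝ, adjForm G' y ≤ ρ * ∑ v, y v ^ 2)
    {L : Finset V} (hL0 : L.Nonempty) (hK : ∀ M : Finset V, M.card = L.card + 1 →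
      (Finset.univ.filter fun u => ∀ m ∈ M, G.Adj m u).card < r) {κ : ℝ} (hκ : 0 ≤ κ)
    (hLx : ∀ l ∈ L, 1 / 2 ≤ x l) (hxκ : ∀ w ∉ L, x w ≤ κ)
    (hmiss : ((Finset.univ.filter fun u => ¬ ∀ l ∈ L, G.Adj l u).card : ℝ)
      ≤ (Fintype.card V : ℝ) / 4) (hρ : 1 ≤ ρ) (hrn : 2 * (r : ℝ) ≤ Fintype.card V)
    (hκ1 : (r + k) * κ ≤ 1 / 4) (hκ2 : r * (8 * k * κ * L.card + 16 * k ^ 2 * κ ^ 2) ≤ 1 / 16)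
    {l v : V} (hl : l ∈ L) (hv : v ≠ l) : G.Adj l v := by
  have hk : 0 < k := zero_lt_one.trans_le h.one_le
  set S := ∑ l ∈ L, x l with hS
  have hS1 : 1 / 2 ≤ S := by
    obtain ⟨l, hl⟩ := hL0
    exact (hLx l hl).trans (Finset.single_le_sum (f := x) (fun v _ => h.nonneg v) hl)
  have hSL : S ≤ L.card := by
    calc S ≤ ∑ l ∈ L, (1 : ℝ) := Finset.sum_le_sum fun l _ => h.le_one l
      _ = L.card := by simp
  have hsplit : ∀ w, ρ * x w ≤ ∑ u ∈ (nbrs G w).filter (· ∈ L), x u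
      + ((nbrs G w).filter (· ∉ L)).card * κ := by
    intro w
    rw [← h.sum_nbrs, ← Finset.sum_filter_add_sum_filter_not (nbrs G w) (· ∈ L), ← nsmul_eq_mul]
    exact add_le_add_right
      (Finset.sum_le_card_nsmul _ _ _ fun u hu => hxκ u (Finset.mem_filter.1 hu).2) _
  -- At most a quarter of the vertices have degree above 4k and at most a quarter miss part of L.
  -- The remaining half contains r vertices.
  obtain ⟨I, hIsub, hIr⟩ : ∃ I : Finset V, (∀ j ∈ I, (∀ l ∈ L, G.Adj l j) ∧
      ((nbrs G j).card : ℝ) ≤ 4 * k) ∧ I.card = r := by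
    set X : Finset V := Finset.univ.filter fun u => 4 * k < (nbrs G u).card with hX
    set Y : Finset V := Finset.univ.filter fun u => ¬ ∀ l ∈ L, G.Adj l u with hY
    have h1 : (X.card : ℝ) * (4 * k) ≤ k * Fintype.card V := by
      calc (X.card : ℝ) * (4 * k) = ∑ z ∈ X, 4 * k := by rw [Finset.sum_const, nsmul_eq_mul]
        _ ≤ ∑ z ∈ X, ((nbrs G z).card : ℝ) :=
            Finset.sum_le_sum fun z hz => (Finset.mem_filter.1 hz).2.le
        _ ≤ ∑ z, ((nbrs G z).card : ℝ) := Finset.sum_le_sum_of_subset_of_nonneg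
            (Finset.subset_univ _) fun _ _ _ => Nat.cast_nonneg _
        _ ≤ _ := h.sum_card_nbrs_le
    have h2 : (X.card : ℝ) ≤ Fintype.card V / 4 := by
      have : k * (X.card : ℝ) ≤ k * (Fintype.card V / 4) := by linarith
      exact le_of_mul_le_mul_left this hk
    have h3 : (Fintype.card V : ℝ) ≤ (X ∪ Y)ᶜ.card + (X.card + Y.card) := by
      have e := Finset.card_compl_add_card (X ∪ Y)
      have e' := Finset.card_union_le X Y
      exact_mod_cast (by omega : Fintype.card V ≤ (X ∪ Y)ᶜ.card + (X.card + Y.card))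
    have h4 : r ≤ ((X ∪ Y)ᶜ).card := by
      have : (r : ℝ) ≤ ((X ∪ Y)ᶜ).card := by linarith
      exact_mod_cast this
    obtain ⟨I, hI, hIc⟩ := Finset.exists_subset_card_eq h4
    refine ⟨I, fun j hj => ?_, hIc⟩
    have hj' := Finset.mem_compl.1 (hI hj)
    constructor
    · by_contra hc
      exact hj' (Finset.mem_union_right _ (Finset.mem_filter.2 ⟨Finset.mem_univ _, hc⟩))
    · by_contra hc
      exact hj' (Finset.mem_union_left _ (Finset.mem_filter.2 ⟨Finset.mem_univ _, not_le.1 hc⟩))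
  have hLI : Disjoint L I :=
    Finset.disjoint_left.2 fun u hu hu' => G.irrefl ((hIsub u hu').1 u hu)
  have hIsum : -(1 / 16) ≤ ∑ j ∈ I, (S ^ 2 - (ρ * x j) ^ 2) := by
    have h1 : ∀ j ∈ I, -(8 * k * κ * L.card + 16 * k ^ 2 * κ ^ 2) ≤ S ^ 2 - (ρ * x j) ^ 2 := by
      intro j hj
      have h2 : ρ * x j ≤ S + 4 * k * κ := by
        refine (hsplit j).trans (add_le_add ?_ (mul_le_mul_of_nonneg_right (le_trans ?_
          (hIsub j hj).2) hκ))
        · exact Finset.sum_le_sum_of_subset_of_nonneg (fun u hu => (Finset.mem_filter.1 hu).2)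
            fun u _ _ => h.nonneg u
        · exact_mod_cast Finset.card_filter_le _ _
      have h3 : (ρ * x j) ^ 2 ≤ (S + 4 * k * κ) ^ 2 :=
        pow_le_pow_left₀ (mul_nonneg h.pos.le (h.nonneg j)) h2 2
      have h4 := mul_le_mul_of_nonneg_left hSL (by positivity : 0 ≤ 8 * k * κ)
      linarith
    calc -(1 / 16) ≤ I.card • (-(8 * k * κ * L.card + 16 * k ^ 2 * κ ^ 2)) := by
          rw [nsmul_eq_mul, hIr]
          linarith
      _ ≤ _ := Finset.card_nsmul_le_sum _ _ _ h1
  have hkeep : ∀ J : Finset V, ∀ u v : V, (if u ∈ J then (0 : ℝ) else x u) ≠ 0 →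
      (if v ∈ J then (0 : ℝ) else x v) ≠ 0 → G.Adj u v → (pendantGraph G L J).Adj u v := by
    intro J u v hu hv huv
    have hu' : u ∉ J := fun hc => hu (if_pos hc)
    have hv' : v ∉ J := fun hc => hv (if_pos hc)
    exact ⟨huv.ne, Or.inr (Or.inr (Or.inr ⟨hu', hv', huv⟩))⟩
  have hz0 : ∀ J : Finset V, ∀ v : V, 0 ≤ if v ∈ J then (0 : ℝ) else x v := fun J v => by
    split_ifs
    exacts [le_rfl, h.nonneg v]
  by_cases hvL : v ∈ L
  · by_contra hlv
    have h1 := sum_sq_sub_sq_add_le_zero h.pos h.nonneg h.eig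
      (hmax _ (pendantGraph_not_isMinor hF hLI subset_rfl hIr.ge fun j hj => (hIsub j hj).1)) hLI
      (fun j hj v => pendantGraph_adj_iff hLI hj v)
      (adjForm_add_le (hz0 I) (hkeep I) hlv ⟨hv.symm, Or.inl ⟨hl, hvL⟩⟩)
    rw [if_neg (Finset.disjoint_left.1 hLI hl), if_neg (Finset.disjoint_left.1 hLI hvL)] at h1
    have h2 : 1 / 2 * (1 / 2) ≤ x l * x v :=
      mul_le_mul (hLx l hl) (hLx v hvL) (by norm_num) (h.nonneg l)
    have h3 : 1 * (2 * (x l * x v)) ≤ ρ * (2 * (x l * x v)) :=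
      mul_le_mul_of_nonneg_right hρ (by linarith)
    linarith
  by_contra hlv
  set E : Finset V := Finset.univ.filter fun u => u ∉ L ∧ ¬ ∀ l ∈ L, G.Adj l u with hE
  have hEne : E.Nonempty := ⟨v, Finset.mem_filter.2 ⟨Finset.mem_univ _, hvL, fun hc => hlv (hc l hl)⟩⟩
  -- Sparsity on E gives a vertex with few neighbours in E. Its remaining neighbours outside L are
  -- common to it and L, so it has at most r + k neighbours outside L, all of small entry.
  obtain ⟨w, hwE, hwk⟩ : ∃ w ∈ E, ((E.filter (G.Adj w)).card : ℝ) ≤ k := by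
    refine Finset.exists_le_of_sum_le hEne ?_
    rw [Finset.sum_const, nsmul_eq_mul, mul_comm]
    have := h.sparse E
    rw [adjPairs] at this
    exact_mod_cast this
  obtain ⟨hwL, hwmiss⟩ := (Finset.mem_filter.1 hwE).2
  push Not at hwmiss
  obtain ⟨m, hm, hmw⟩ := hwmiss
  have hwI : w ∉ I := fun hc => hmw ((hIsub w hc).1 m hm)
  have hLJ : Disjoint L (insert w I) := Finset.disjoint_insert_right.2 ⟨hwL, hLI⟩
  have h1 := sum_sq_sub_sq_add_le_zero (g := 0) h.pos h.nonneg h.eig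
    (hmax _ (pendantGraph_not_isMinor hF hLJ (Finset.subset_insert w I) hIr.ge
      fun j hj => (hIsub j hj).1)) hLJ
    (fun j hj v => pendantGraph_adj_iff hLJ hj v)
    (by rw [add_zero]; exact adjForm_mono (hz0 _) (hkeep _))
  rw [Finset.sum_insert hwI, mul_zero, add_zero] at h1
  have h2 : ∑ u ∈ (nbrs G w).filter (· ∈ L), x u ≤ S - 1 / 2 := by
    have e : S = x m + ∑ u ∈ L.erase m, x u := (Finset.add_sum_erase L x hm).symm
    have h3 : ∑ u ∈ (nbrs G w).filter (· ∈ L), x u ≤ ∑ u ∈ L.erase m, x u := by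
      refine Finset.sum_le_sum_of_subset_of_nonneg (fun u hu => ?_) fun u _ _ => h.nonneg u
      obtain ⟨hu1, hu2⟩ := Finset.mem_filter.1 hu
      refine Finset.mem_erase.2 ⟨?_, hu2⟩
      rintro rfl
      exact hmw (mem_nbrs.1 hu1).symm
    have := hLx m hm
    linarith
  have h3 : (((nbrs G w).filter (· ∉ L)).card : ℝ) ≤ r + k := by
    have h4 : (nbrs G w).filter (· ∉ L) ⊆
        (Finset.univ.filter fun u => ∀ m ∈ insert w L, G.Adj m u) ∪ E.filter (G.Adj w) := by
      intro u hu
      obtain ⟨hu1, hu2⟩ := Finset.mem_filter.1 hu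
      have hwu := mem_nbrs.1 hu1
      by_cases hc : ∀ l ∈ L, G.Adj l u
      · refine Finset.mem_union_left _ (Finset.mem_filter.2 ⟨Finset.mem_univ _, fun m hm => ?_⟩)
        rcases Finset.mem_insert.1 hm with rfl | hm
        exacts [hwu, hc m hm]
      · exact Finset.mem_union_right _ (Finset.mem_filter.2
          ⟨Finset.mem_filter.2 ⟨Finset.mem_univ _, hu2, hc⟩, hwu⟩)
    have h5 := (Finset.card_le_card h4).trans (Finset.card_union_le _ _)
    have h6 := hK (insert w L) (Finset.card_insert_of_notMem hwL)
    calc (((nbrs G w).filter (· ∉ L)).card : ℝ) ≤ r + (E.filter (G.Adj w)).card := by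
          exact_mod_cast h5.trans (Nat.add_le_add_right h6.le _)
      _ ≤ _ := add_le_add_right hwk _
  have h4 : ρ * x w ≤ S - 1 / 4 := by
    have := mul_le_mul_of_nonneg_right h3 hκ
    have := hsplit w
    linarith
  have h5 : (ρ * x w) ^ 2 ≤ (S - 1 / 4) ^ 2 :=
    pow_le_pow_left₀ (mul_nonneg h.pos.le (h.nonneg w)) h4 2
  linarith

end Dominating

/-! ### Choice of constants and dominating vertices in extremal graphs -/

section Extremal
open scoped Classical

/-- A maximum clique of `H` is independent in `completeMinus H` and leaves γ + 1 vertices, so r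
common neighbours would yield a minor by `IsMinor.of_common_neighbors`. -/
lemma card_common_neighbors_lt {V : Type*} [Fintype V] {r γ : ℕ} {H : SimpleGraph (Fin r)}
    (hr : γ + 1 + H.cliqueNum = r) {G : SimpleGraph V} (hG : ¬ IsMinor (completeMinus H) G)
    (M : Finset V) (hM : M.card = γ + 1) :
    (Finset.univ.filter fun u => ∀ m ∈ M, G.Adj m u).card < r := by
  by_contra hc
  obtain ⟨C, hC, hCr⟩ := Finset.exists_subset_card_eq (not_lt.1 hc)
  obtain ⟨s, hs⟩ := H.exists_isNClique_cliqueNum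
  have hsM : (sᶜ).card = M.card := by
    rw [Finset.card_compl, hs.card_eq, Fintype.card_fin, hM]
    omega
  let e := Finset.equivOfCardEq hsM
  let c := (Finset.equivFinOfCardEq hCr).symm
  let m : Fin r → V := fun i => if hi : i ∈ sᶜ then (e ⟨i, hi⟩ : V) else c i
  have hm : ∀ i (hi : i ∈ sᶜ), m i = e ⟨i, hi⟩ := fun i hi => dif_pos hi
  refine hG (IsMinor.of_common_neighbors (I := (s : Set (Fin r))) ?_ m (fun i => (c i : V)) ?_
    (fun i j hij => c.injective (Subtype.ext hij)) ?_)
  · intro i hi j hj hij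
    rw [completeMinus_adj] at hij
    exact hij.2 (hs.isClique hi hj hij.1)
  · intro i hi j hj hij
    have hi' : i ∈ sᶜ := Finset.mem_compl.2 hi
    have hj' : j ∈ sᶜ := Finset.mem_compl.2 hj
    rw [hm i hi', hm j hj'] at hij
    exact congrArg Subtype.val (e.injective (Subtype.ext hij))
  · intro i hi j
    have hi' : i ∈ sᶜ := Finset.mem_compl.2 hi
    rw [hm i hi']
    exact (Finset.mem_filter.1 (hC (c j).2)).2 _ (e ⟨i, hi'⟩).2

/-- A minor-free graph with many dominating vertices. -/
lemma exists_dominated_not_isMinor {r γ n : ℕ} {H : SimpleGraph (Fin r)}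
    (hr : γ + 1 + H.cliqueNum = r) (hn : γ ≤ n) : ∃ (G : SimpleGraph (Fin n)) (L : Finset (Fin n)),
      L.card = γ ∧ (∀ l ∈ L, ∀ v, v ≠ l → G.Adj l v) ∧ ¬ IsMinor (completeMinus H) G := by
  obtain ⟨L, -, hL⟩ := Finset.exists_subset_card_eq
    (show γ ≤ (Finset.univ : Finset (Fin n)).card by simpa using hn)
  refine ⟨pendantGraph ⊥ L Lᶜ, L, hL, fun l hl v hv => ⟨hv.symm, ?_⟩,
    not_isMinor_of_independent L (by omega) fun u v hu hv huv => ?_⟩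
  · by_cases hvL : v ∈ L
    · exact Or.inl ⟨hl, hvL⟩
    · exact Or.inr (Or.inl ⟨hl, Finset.mem_compl.2 hvL⟩)
  · obtain ⟨-, h | h | h | h⟩ := huv
    · exact hu h.1
    · exact hu h.1
    · exact hv h.2
    · exact h.2.2

lemma eventually_le_mul_natCast (C : ℝ) {η : ℝ} (hη : 0 < η) :
    ∀ᶠ n : ℕ in Filter.atTop, C ≤ η * n :=
  (tendsto_natCast_atTop_atTop.const_mul_atTop hη).eventually_ge_atTop C

/-- Extremal graphs of large order have `γ` dominating vertices. -/
lemma exists_dominating_of_mem_SPEX {r γ : ℕ} (H : SimpleGraph (Fin r)) (hγ : 1 ≤ γ)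
    (hr : γ + 1 + H.cliqueNum = r) : ∃ N : ℕ, ∀ n : ℕ, N ≤ n → ∀ G ∈ SPEX n (completeMinus H),
      ∃ L : Finset (Fin n), L.card = γ ∧ ∀ l ∈ L, ∀ v, v ≠ l → G.Adj l v := by
  obtain ⟨k₀, hk₀, hsparse⟩ := exists_adjPairs_le.{0} (completeMinus H)
  obtain ⟨k, hk⟩ : ∃ k : ℝ, k = k₀ := ⟨_, rfl⟩
  have hk1 : 1 ≤ k := by
    rw [hk]
    exact_mod_cast hk₀
  have hγ1 : (1 : ℝ) ≤ γ := by exact_mod_cast hγ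
  have hr0 : (0 : ℝ) ≤ r := Nat.cast_nonneg r
  -- Constants are fixed in the order δ, κ, θ, η, each in terms of earlier ones and of r, γ, k; only
  -- then is n taken large. The 400 in κ makes the total cost 24/400 fall below the 1/16 of
  -- `SparsePerron.dominating`.
  obtain ⟨δ, hδ⟩ : ∃ δ : ℝ, δ = 1 / (8 * (γ + 1)) := ⟨_, rfl⟩
  have hδ0 : 0 < δ := by rw [hδ]; positivity
  have hδγ : (γ + 1) * (2 * δ) = 1 / 4 := by
    rw [hδ]
    field_simp
    norm_num
  have hδ1 : δ ≤ 1 / 8 := by nlinarith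
  obtain ⟨κ, hκ⟩ : ∃ κ : ℝ, κ = 1 / (400 * ((r + 1) * k ^ 2 * γ)) := ⟨_, rfl⟩
  have hκ0 : 0 < κ := by rw [hκ]; positivity
  have hκe : ((r + 1) * k ^ 2 * γ) * κ = 1 / 400 := by
    rw [hκ]
    field_simp
  have hkk : k ≤ k ^ 2 := by nlinarith
  have hkγ : k ^ 2 ≤ k ^ 2 * γ := le_mul_of_one_le_right (by positivity) hγ1
  have hκ1 : (r + k) * κ ≤ 1 / 4 := by
    have h1 : r + k ≤ (r + 1) * k ^ 2 * γ := by
      have : (r : ℝ) * 1 ≤ r * (k ^ 2 * γ) := mul_le_mul_of_nonneg_left (by linarith) hr0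
      linarith
    have := mul_le_mul_of_nonneg_right h1 hκ0.le
    linarith
  have hκle : κ ≤ 1 := by
    have : 1 * κ ≤ (r + k) * κ := mul_le_mul_of_nonneg_right (by linarith) hκ0.le
    linarith
  have hκ2 : r * (8 * k * κ * γ + 16 * k ^ 2 * κ ^ 2) ≤ 1 / 16 := by
    have h1 : 8 * k * κ * γ ≤ 8 * (k ^ 2 * γ * κ) := by
      have := mul_le_mul_of_nonneg_right hkk (by positivity : 0 ≤ κ * γ)
      linarith
    have h2 : 16 * k ^ 2 * κ ^ 2 ≤ 16 * (k ^ 2 * γ * κ) := by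
      have e1 : κ ^ 2 ≤ κ := by nlinarith
      have e2 := mul_le_mul_of_nonneg_left e1 (by positivity : 0 ≤ k ^ 2)
      have e3 := mul_le_mul_of_nonneg_right hkγ hκ0.le
      linarith
    have h3 := mul_le_mul_of_nonneg_left (add_le_add h1 h2) hr0
    have h4 : 0 < k ^ 2 * γ * κ := by positivity
    linarith
  obtain ⟨θ, hθ⟩ : ∃ θ : ℝ, θ = κ / (8 * k) := ⟨_, rfl⟩
  have hθ0 : 0 < θ := by rw [hθ]; positivity
  have hθκ : 8 * k * θ = κ := by
    rw [hθ]
    field_simp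
  have hθ1 : θ ≤ 1 / 8 := by nlinarith
  obtain ⟨η, hη⟩ : ∃ η : ℝ, η = δ * θ / (k + 2) := ⟨_, rfl⟩
  have hη0 : 0 < η := by rw [hη]; positivity
  have hηe : η * (k + 2) = δ * θ := by
    rw [hη]
    field_simp
  have hηδ : η * (k + 2) ≤ δ := by
    rw [hηe]
    exact mul_le_of_le_one_right hδ0.le (by linarith)
  have hηκ : 2 * η ≤ κ := by
    have h1 : δ * θ ≤ θ := mul_le_of_le_one_left hθ0.le (by linarith)
    have h2 : 2 * η ≤ η * (k + 2) := by nlinarith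
    have h3 : θ ≤ 8 * k * θ := le_mul_of_one_le_left hθ0.le (by linarith)
    linarith
  obtain ⟨C, hC⟩ : ∃ C : ℝ, C = k / (η / (8 * k)) ^ 2 := ⟨_, rfl⟩
  obtain ⟨a, ha⟩ : ∃ a : ℕ, a = ⌈4 * k ^ 2 / η⌉₊ := ⟨_, rfl⟩
  have hev := (eventually_le_mul_natCast (C ^ 2) (one_half_pos (α := ℝ))).and
    ((eventually_le_mul_natCast ((γ : ℝ) ^ 2) hη0).and
    ((eventually_le_mul_natCast ((2 : ℝ) ^ a * r * a) hη0).and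
    ((eventually_le_mul_natCast (2 * (r : ℝ)) one_pos).and
    ((eventually_le_mul_natCast (8 * k * r) hκ0).and
    (Filter.eventually_ge_atTop (2 * γ + 2))))))
  obtain ⟨N, hN⟩ := Filter.eventually_atTop.1 hev
  refine ⟨N, fun n hn G hG => ?_⟩
  obtain ⟨n1, n2, n3, n4, n5, n6⟩ := hN n hn
  rw [one_mul] at n4
  have hn6 : 2 * (γ : ℝ) + 2 ≤ n := by exact_mod_cast n6
  have : Nonempty (Fin n) := ⟨⟨0, by omega⟩⟩
  have hcard : (Fintype.card (Fin n) : ℝ) = n := by rw [Fintype.card_fin]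
  obtain ⟨ρ, hρ0, hGρ, hGmax, x, hx0, hx1, hxm, heig⟩ := exists_perron G
  have hmax : ∀ G' : SimpleGraph (Fin n), ¬ IsMinor (completeMinus H) G' →
      ∀ y : Fin n → ℝ, adjForm G' y ≤ ρ * ∑ v, y v ^ 2 := by
    intro G' hG' y
    obtain ⟨ρ', -, hGρ', hmax', -⟩ := exists_perron G'
    have hle := hG.2 G' hG'
    rw [hGρ, hGρ', ENNReal.ofReal_le_ofReal_iff hρ0] at hle
    exact (hmax' y).trans (mul_le_mul_of_nonneg_right hle (Finset.sum_nonneg fun v _ => sq_nonneg _))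
  have hργ : (γ : ℝ) * (n - γ) ≤ ρ ^ 2 := by
    obtain ⟨G₀, L₀, hL₀, hG₀, hmin⟩ :=
      exists_dominated_not_isMinor (n := n) hr (by omega)
    have := card_mul_le_sq_of_dominating (Finset.card_pos.1 (by omega)) (by
      rw [hL₀, Fintype.card_fin]
      omega) hG₀ (hmax G₀ hmin)
    rwa [hL₀, hcard] at this
  have hρn : (n : ℝ) / 2 ≤ ρ ^ 2 := by
    have : 1 * ((n : ℝ) - γ) ≤ γ * (n - γ) := mul_le_mul_of_nonneg_right hγ1 (by linarith)
    linarith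
  have hρ1 : 1 ≤ ρ := by
    by_contra hlt
    have := pow_le_one₀ (n := 2) hρ0 (not_le.1 hlt).le
    linarith
  have hρC : C ≤ ρ := (le_abs_self C).trans (abs_le_of_sq_le_sq (by linarith) hρ0)
  have hP : SparsePerron G k ρ x := ⟨hk1, fun X => by
    rw [hk]
    exact_mod_cast hsparse _ G hG.1 X, by linarith, hx0, hx1, hxm, heig⟩
  have hK := card_common_neighbors_lt hr hG.1
  obtain ⟨L, hLγ, hLx, hxκ, hmiss⟩ := hP.exists_core (a := a) hγ hK hcard (by linarith) hδ0
    (by linarith) hη0 hηδ hηe.le (by linarith) hθκ.le hηκ (hC ▸ hρC) hρn hργ n2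
    (ha ▸ Nat.le_ceil _) n3 n4 n5
  refine ⟨L, hLγ, fun l hl v hv => ?_⟩
  refine hP.dominating hG.1 hmax (Finset.card_pos.1 (by omega)) (by rwa [hLγ]) hκ0.le
    (fun l hl => (by linarith : (1 : ℝ) / 2 ≤ 1 - δ).trans (hLx l hl)) hxκ (hmiss.trans ?_) hρ1
    (by rwa [hcard]) hκ1 (by rwa [hLγ]) hl hv
  rw [hcard]
  have := mul_le_mul_of_nonneg_right hθ1 (Nat.cast_nonneg n : (0 : ℝ) ≤ n)
  linarith

end Extremal

/-! ### Identifying the extremal graphs with books -/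

section Books
open scoped Classical

lemma join_adj_inl_inl {V W : Type*} {G : SimpleGraph V} {Q : SimpleGraph W} {a b : V} :
    (join G Q).Adj (Sum.inl a) (Sum.inl b) ↔ G.Adj a b := by simp [join]

lemma join_adj_inr_inr {V W : Type*} {G : SimpleGraph V} {Q : SimpleGraph W} {a b : W} :
    (join G Q).Adj (Sum.inr a) (Sum.inr b) ↔ Q.Adj a b := by simp [join]

lemma join_adj_inl_inr {V W : Type*} {G : SimpleGraph V} {Q : SimpleGraph W} {a : V} {b : W} :
    (join G Q).Adj (Sum.inl a) (Sum.inr b) := by simp [join]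

/-- The vertex bijection that sends `L` to the left summand. -/
noncomputable def splitEquiv {V : Type*} {s t : ℕ} {L : Finset V} (hL : L.card = s)
    (e : {v // v ∉ L} ≃ Fin t) : V ≃ Fin s ⊕ Fin t :=
  (Equiv.sumCompl (· ∈ L)).symm.trans (Equiv.sumCongr (Finset.equivFinOfCardEq hL) e)

lemma splitEquiv_of_mem {V : Type*} {s t : ℕ} {L : Finset V} (hL : L.card = s)
    (e : {v // v ∉ L} ≃ Fin t) {v : V} (hv : v ∈ L) :
    splitEquiv hL e v = Sum.inl (Finset.equivFinOfCardEq hL ⟨v, hv⟩) := by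
  simp [splitEquiv, Equiv.sumCompl_symm_apply_of_pos (p := (· ∈ L)) hv]

lemma splitEquiv_of_notMem {V : Type*} {s t : ℕ} {L : Finset V} (hL : L.card = s)
    (e : {v // v ∉ L} ≃ Fin t) {v : V} (hv : v ∉ L) :
    splitEquiv hL e v = Sum.inr (e ⟨v, hv⟩) := by
  simp [splitEquiv, Equiv.sumCompl_symm_apply_of_neg (p := (· ∈ L)) hv]

lemma nonempty_equiv_compl {n s t : ℕ} {L : Finset (Fin n)} (hL : L.card = s) (hst : s + t = n) :
    Nonempty ({v // v ∉ L} ≃ Fin t) := by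
  refine ⟨Fintype.equivFinOfCardEq ?_⟩
  rw [Fintype.card_subtype_compl, Fintype.card_fin, Fintype.card_coe, hL]
  omega

/-- The join already contains every possible edge at the left summand, so only edges outside L need
control. -/
lemma join_adj_splitEquiv {V : Type*} {s t : ℕ} {L : Finset V} (hL : L.card = s)
    (e : {v // v ∉ L} ≃ Fin t) {G : SimpleGraph V} {Q : SimpleGraph (Fin t)}
    (h : ∀ u v (hu : u ∉ L) (hv : v ∉ L), G.Adj u v → Q.Adj (e ⟨u, hu⟩) (e ⟨v, hv⟩)) {u v : V}
    (huv : G.Adj u v) :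
    (join (⊤ : SimpleGraph (Fin s)) Q).Adj (splitEquiv hL e u) (splitEquiv hL e v) := by
  by_cases hu : u ∈ L <;> by_cases hv : v ∈ L
  · rw [splitEquiv_of_mem hL e hu, splitEquiv_of_mem hL e hv, join_adj_inl_inl, top_adj]
    exact fun hc => huv.ne (congrArg Subtype.val ((Finset.equivFinOfCardEq hL).injective hc))
  · rw [splitEquiv_of_mem hL e hu, splitEquiv_of_notMem hL e hv]
    exact join_adj_inl_inr
  · rw [splitEquiv_of_notMem hL e hu, splitEquiv_of_mem hL e hv]
    exact join_adj_inl_inr.symm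
  · rw [splitEquiv_of_notMem hL e hu, splitEquiv_of_notMem hL e hv, join_adj_inr_inr]
    exact h u v hu hv huv

lemma containsSpanning_book {n s t : ℕ} {G : SimpleGraph (Fin n)} {L : Finset (Fin n)}
    (hL : L.card = s) (hst : s + t = n) (hG : ∀ l ∈ L, ∀ v, v ≠ l → G.Adj l v) :
    ContainsSpanning G (book s t) := by
  obtain ⟨e⟩ := nonempty_equiv_compl hL hst
  have h : ∀ a b, (book s t).Adj a b →
      G.Adj ((splitEquiv hL e).symm a) ((splitEquiv hL e).symm b) := by
    intro a b hab
    obtain ⟨u, rfl⟩ := (splitEquiv hL e).surjective a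
    obtain ⟨v, rfl⟩ := (splitEquiv hL e).surjective b
    rw [Equiv.symm_apply_apply, Equiv.symm_apply_apply]
    have huv : u ≠ v := fun hc => hab.ne (congrArg _ hc)
    by_cases hu : u ∈ L
    · exact hG u hu v huv.symm
    · by_cases hv : v ∈ L
      · exact (hG v hv u huv).symm
      · rw [splitEquiv_of_notMem hL e hu, splitEquiv_of_notMem hL e hv] at hab
        exact absurd (join_adj_inr_inr.1 hab) id
  exact ⟨⟨(splitEquiv hL e).symm, fun {a b} hab => h a b hab⟩, (splitEquiv hL e).symm.bijective⟩

/-- A matching on `X` can be enumerated so that matched vertices come in consecutive pairs. -/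
lemma exists_pairing {V : Type*} {G : SimpleGraph V} (X : Finset V)
    (hG : ∀ u ∈ X, ∀ v ∈ X, ∀ w ∈ X, G.Adj u v → G.Adj u w → v = w) :
    ∃ f : V → ℕ, Set.InjOn f X ∧ (∀ v ∈ X, f v < X.card) ∧
      ∀ u ∈ X, ∀ v ∈ X, G.Adj u v → f u / 2 = f v / 2 := by
  induction X using Finset.strongInduction with
  | H X ih =>
    by_cases hE : ∃ a ∈ X, ∃ b ∈ X, G.Adj a b
    · obtain ⟨a, ha, b, hb, hab⟩ := hE
      have hba : b ∈ X.erase a := Finset.mem_erase.2 ⟨hab.ne', hb⟩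
      have hcard : ((X.erase a).erase b).card + 2 = X.card := by
        have h1 := Finset.card_erase_add_one ha
        have h2 := Finset.card_erase_add_one hba
        omega
      have hsub : (X.erase a).erase b ⊆ X :=
        (Finset.erase_subset _ _).trans (Finset.erase_subset _ _)
      obtain ⟨f, hf1, hf2, hf3⟩ := ih ((X.erase a).erase b)
        (Finset.ssubset_of_subset_of_ssubset (Finset.erase_subset _ _) (Finset.erase_ssubset ha))
        fun u hu v hv w hw => hG u (hsub hu) v (hsub hv) w (hsub hw)
      -- Shifting by 2 keeps the earlier pairs consecutive and frees the pair {0, 1} for the edge `a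
      -- b`.
      let g : V → ℕ := fun v => if v = a then 0 else if v = b then 1 else f v + 2
      have hga : g a = 0 := if_pos rfl
      have hgb : g b = 1 := by simp [g, hab.ne']
      have hg : ∀ v, v ≠ a → v ≠ b → g v = f v + 2 := fun v h1 h2 => by simp [g, h1, h2]
      have hcases : ∀ v ∈ X, v = a ∨ v = b ∨ (v ≠ a ∧ v ≠ b ∧ v ∈ (X.erase a).erase b) := by
        intro v hv
        by_cases h1 : v = a
        · exact Or.inl h1
        · by_cases h2 : v = b
          · exact Or.inr (Or.inl h2)
          · exact Or.inr (Or.inr ⟨h1, h2, by simp [h1, h2, hv]⟩)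
      refine ⟨g, fun u hu v hv huv => ?_, fun v hv => ?_, fun u hu v hv huv => ?_⟩
      · rcases hcases u hu with rfl | rfl | ⟨u1, u2, u3⟩ <;>
          rcases hcases v hv with rfl | rfl | ⟨v1, v2, v3⟩
        · rfl
        · omega
        · rw [hga, hg v v1 v2] at huv
          omega
        · omega
        · rfl
        · rw [hgb, hg v v1 v2] at huv
          omega
        · rw [hga, hg u u1 u2] at huv
          omega
        · rw [hgb, hg u u1 u2] at huv
          omega
        · rw [hg u u1 u2, hg v v1 v2] at huv
          exact hf1 u3 v3 (by omega)
      · rcases hcases v hv with rfl | rfl | ⟨v1, v2, v3⟩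
        · omega
        · omega
        · have := hf2 v v3
          rw [hg v v1 v2]
          omega
      · rcases hcases u hu with rfl | rfl | ⟨u1, u2, u3⟩
        · obtain rfl := hG u hu v hv b hb huv hab
          rw [hga, hgb]
        · obtain rfl := hG u hu v hv a ha huv hab.symm
          rw [hga, hgb]
        · rcases hcases v hv with rfl | rfl | ⟨v1, v2, v3⟩
          · exact absurd (hG v hv u hu b hb huv.symm hab) u2
          · exact absurd (hG v hv u hu a ha huv.symm hab.symm) u1
          · have := hf3 u u3 v v3 huv
            rw [hg u u1 u2, hg v v1 v2]
            omega
    · push Not at hE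
      refine ⟨fun v => if hv : v ∈ X then X.equivFin ⟨v, hv⟩ else 0, fun u hu v hv huv => ?_,
        fun v hv => ?_, fun u hu v hv huv => absurd huv (hE u hu v hv)⟩
      · have hu' : u ∈ X := hu
        have hv' : v ∈ X := hv
        simp only [dif_pos hu', dif_pos hv'] at huv
        exact congrArg Subtype.val (X.equivFin.injective (Fin.ext huv))
      · simp only [dif_pos hv]
        exact (X.equivFin ⟨v, hv⟩).2

lemma exists_equiv_isolatedEdges {n s t : ℕ} {G : SimpleGraph (Fin n)} {L : Finset (Fin n)}
    (hL : L.card = s) (hst : s + t = n)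
    (hG : ∀ u v w, u ∉ L → v ∉ L → w ∉ L → G.Adj u v → G.Adj u w → v = w) :
    ∃ e : {v // v ∉ L} ≃ Fin t, ∀ u v (hu : u ∉ L) (hv : v ∉ L), G.Adj u v →
      (isolatedEdges t (t / 2)).Adj (e ⟨u, hu⟩) (e ⟨v, hv⟩) := by
  have hc : (Lᶜ).card = t := by
    rw [Finset.card_compl, Fintype.card_fin, hL]
    omega
  obtain ⟨f, hf1, hf2, hf3⟩ := exists_pairing (G := G) Lᶜ fun u hu v hv w hw =>
    hG u v w (Finset.mem_compl.1 hu) (Finset.mem_compl.1 hv) (Finset.mem_compl.1 hw)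
  rw [hc] at hf2
  let g : {v // v ∉ L} → Fin t := fun v => ⟨f v, hf2 v (Finset.mem_compl.2 v.2)⟩
  have hg : Function.Injective g := fun u v huv => Subtype.ext
    (hf1 (Finset.mem_coe.2 (Finset.mem_compl.2 u.2)) (Finset.mem_coe.2 (Finset.mem_compl.2 v.2))
      (congrArg Fin.val huv))
  have hcard : Fintype.card {v // v ∉ L} = Fintype.card (Fin t) := by
    rw [Fintype.card_subtype_compl, Fintype.card_fin, Fintype.card_coe, hL, Fintype.card_fin]
    omega
  refine ⟨Equiv.ofBijective g ((Fintype.bijective_iff_injective_and_card g).2 ⟨hg, hcard⟩),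
    fun u v hu hv huv => ?_⟩
  have h1 := hf3 u (Finset.mem_compl.2 hu) v (Finset.mem_compl.2 hv) huv
  have h2 : f u ≠ f v := fun h => huv.ne (hf1 (Finset.mem_coe.2 (Finset.mem_compl.2 hu))
    (Finset.mem_coe.2 (Finset.mem_compl.2 hv)) h)
  have h3 := hf2 u (Finset.mem_compl.2 hu)
  have h4 := hf2 v (Finset.mem_compl.2 hv)
  refine ⟨fun h => h2 (congrArg Fin.val h), h1, ?_⟩
  -- For odd t the last position has no partner. Two distinct positions below t with the same half
  -- form a complete pair, so that half is below `t / 2`.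
  change f u / 2 < t / 2
  omega

lemma not_isMinor_book {r s t : ℕ} {H : SimpleGraph (Fin r)} (h : s + H.cliqueNum < r) :
    ¬ IsMinor (completeMinus H) (book s t) := by
  refine not_isMinor_of_independent (Finset.univ.map Function.Embedding.inl) (by simpa using h) ?_
  rintro (u | u) (v | v) hu hv huv
  · simp at hu
  · simp at hu
  · simp at hv
  · exact join_adj_inr_inr.1 huv

lemma not_isMinor_bookWithEdges {r k s t : ℕ} {H : SimpleGraph (Fin r)} (hH : EdgesDisjoint H)
    (h : s + 3 ≤ r) : ¬ IsMinor (completeMinus H) (bookWithEdges k s t) := by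
  refine not_isMinor_of_edgesDisjoint hH (Finset.univ.map Function.Embedding.inl)
    (by simpa using h) ?_
  rintro (u | u) (v | v) (w | w) hu hv hw huv huw
  any_goals simp at hu
  any_goals simp at hv
  any_goals simp at hw
  obtain ⟨h1, h2, -⟩ := join_adj_inr_inr.1 huv
  obtain ⟨h3, h4, -⟩ := join_adj_inr_inr.1 huw
  have : v = w := by omega
  rw [this]

/-- Three vertices besides the dominating ones suffice for a minor. -/
lemma isMinor_of_triple {V : Type*} {r : ℕ} {H : SimpleGraph (Fin r)} {G : SimpleGraph V}
    {L : Finset V} (hL : L.card + 3 = r) (hG : ∀ l ∈ L, ∀ v, v ≠ l → G.Adj l v) {a b c : Fin r}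
    (hab : a ≠ b) (hac : a ≠ c) (hbc : b ≠ c) {u v w : V} (hu : u ∉ L) (hv : v ∉ L) (hw : w ∉ L)
    (huv : u ≠ v) (huw : u ≠ w) (hvw : v ≠ w) (h1 : ¬ H.Adj a b → G.Adj u v)
    (h2 : ¬ H.Adj a c → G.Adj u w) (h3 : ¬ H.Adj b c → G.Adj v w) :
    IsMinor (completeMinus H) G := by
  set T : Finset (Fin r) := {a, b, c} with hT
  have hTc : (Tᶜ).card = L.card := by
    rw [Finset.card_compl, Fintype.card_fin, Finset.card_eq_three.2 ⟨a, b, c, hab, hac, hbc, hT⟩]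
    omega
  let e := Finset.equivOfCardEq hTc
  -- The other r - 3 vertices go bijectively onto L, where all adjacencies are present, so only the
  -- three pairs in T need checking.
  let f : Fin r → V := fun i => if hi : i ∈ Tᶜ then (e ⟨i, hi⟩ : V) else
    if i = a then u else if i = b then v else w
  have hf : ∀ i (hi : i ∈ Tᶜ), f i = e ⟨i, hi⟩ := fun i hi => dif_pos hi
  have hfL : ∀ i, i ∈ Tᶜ → f i ∈ L := fun i hi => by
    rw [hf i hi]
    exact (e ⟨i, hi⟩).2
  have hfa : f a = u := by simp [f, hT]
  have hfb : f b = v := by simp [f, hT, hab.symm]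
  have hfc : f c = w := by simp [f, hT, hac.symm, hbc.symm]
  have hcases : ∀ i, i ∈ Tᶜ ∨ i = a ∨ i = b ∨ i = c := by
    intro i
    by_cases hi : i ∈ T
    · exact Or.inr (by simpa [hT] using hi)
    · exact Or.inl (Finset.mem_compl.2 hi)
  have hinj : Function.Injective f := by
    intro i j hij
    have key : ∀ i j, f i = f j → i ∈ Tᶜ → i = j := by
      intro i j hij hi
      have hiL := hfL i hi
      rcases hcases j with hj | rfl | rfl | rfl
      · rw [hf i hi, hf j hj] at hij
        exact congrArg Subtype.val (e.injective (Subtype.ext hij))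
      · exact absurd (hfa ▸ hij ▸ hiL) hu
      · exact absurd (hfb ▸ hij ▸ hiL) hv
      · exact absurd (hfc ▸ hij ▸ hiL) hw
    rcases hcases i with hi | hi
    · exact key i j hij hi
    rcases hcases j with hj | hj
    · exact (key j i hij.symm hj).symm
    rcases hi with rfl | rfl | rfl <;> rcases hj with rfl | rfl | rfl <;>
      simp only [hfa, hfb, hfc] at hij <;>
      first
      | rfl
      | exact absurd hij huv
      | exact absurd hij huw
      | exact absurd hij hvw
      | exact absurd hij.symm huv
      | exact absurd hij.symm huw
      | exact absurd hij.symm hvw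
  refine IsMinor.of_injective f hinj fun i j hij => ?_
  obtain ⟨hne, hH⟩ := completeMinus_adj.1 hij
  have hH' : ¬ H.Adj j i := fun h => hH h.symm
  rcases hcases i with hi | hi
  · exact hG _ (hfL i hi) _ fun h => hne (hinj h).symm
  rcases hcases j with hj | hj
  · exact (hG _ (hfL j hj) _ fun h => hne (hinj h)).symm
  rcases hi with rfl | rfl | rfl <;> rcases hj with rfl | rfl | rfl <;>
    simp only [hfa, hfb, hfc] <;>
    first
    | exact absurd rfl hne
    | exact h1 hH
    | exact h2 hH
    | exact h3 hH
    | exact (h1 hH').symm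
    | exact (h2 hH').symm
    | exact (h3 hH').symm

lemma SPEX_nonempty {W : Type*} {n : ℕ} {F : SimpleGraph W} {G : SimpleGraph (Fin n)}
    (hG : ¬ IsMinor F G) : (SPEX n F).Nonempty := by
  obtain ⟨G₀, h1, h2⟩ := Set.exists_max_image {G : SimpleGraph (Fin n) | ¬ IsMinor F G}
    graphSpectralRadius (Set.toFinite _) ⟨G, hG⟩
  exact ⟨G₀, h1, h2⟩

/-- An extremal graph with a dominating vertex is not a proper spanning subgraph of a graph without
the given minor. -/
lemma nonempty_iso_of_mem_SPEX {W W' : Type*} {n : ℕ} {F : SimpleGraph W}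
    {G : SimpleGraph (Fin n)} (hG : G ∈ SPEX n F) {l : Fin n} (hl : ∀ v, v ≠ l → G.Adj l v)
    {X : SimpleGraph W'} (hX : ¬ IsMinor F X) (φ : Fin n ≃ W')
    (hφ : ∀ u v, G.Adj u v → X.Adj (φ u) (φ v)) : Nonempty (G ≃g X) := by
  have hle : G ≤ X.comap φ := fun u v huv => hφ u v huv
  have hmin : ¬ IsMinor F (X.comap φ) := fun h => hX (h.of_bijective φ fun u v huv => huv)
  have heq : G = X.comap φ := by
    by_contra hne
    exact absurd (graphSpectralRadius_lt (lt_of_le_of_ne hle hne) hl) (not_lt.2 (hG.2 _ hmin))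
  rw [heq]
  exact ⟨Iso.comap φ X⟩

/-- There are finitely many graphs on `Fin n`, so some extremal graph exists. It is isomorphic to X,
hence every copy of X attains the maximum. -/
lemma mem_SPEX_iff_of_unique {W W' : Type*} {n : ℕ} {F : SimpleGraph W} {X : SimpleGraph W'}
    (hX : ¬ IsMinor F X) (h : ∀ G ∈ SPEX n F, Nonempty (G ≃g X)) (G : SimpleGraph (Fin n)) :
    G ∈ SPEX n F ↔ Nonempty (G ≃g X) := by
  refine ⟨h G, fun ⟨e⟩ => ?_⟩
  have hG : ¬ IsMinor F G := fun hm => hX (hm.of_bijective e.toEquiv fun u v => e.map_adj_iff.2)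
  obtain ⟨G₀, hG₀⟩ := SPEX_nonempty hG
  obtain ⟨e₀⟩ := h G₀ hG₀
  refine ⟨hG, fun G' hG' => ?_⟩
  rw [graphSpectralRadius_congr (e.trans e₀.symm)]
  exact hG₀.2 G' hG'

end Books
end MinorSpectral

/-! ### The main theorem -/

open MinorSpectral in
theorem theorem1p5 (r : ℕ) (H : SimpleGraph (Fin r)) (hr : H.cliqueNum + 2 ≤ r) :
    ∃ N : ℕ, ∀ n : ℕ, N ≤ n →
      (∀ G ∈ SPEX n (completeMinus H),
        ContainsSpanning G (book (r - H.cliqueNum - 1) (n - (r - H.cliqueNum - 1)))) ∧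
      (H.cliqueNum = 2 → EdgesDisjoint H →
        ∀ G : SimpleGraph (Fin n), G ∈ SPEX n (completeMinus H) ↔
          Nonempty (G ≃g bookWithEdges ((n - r + 3) / 2) (r - 3) (n - r + 3))) ∧
      (H.cliqueNum = 2 → ¬ EdgesDisjoint H →
        ∀ G : SimpleGraph (Fin n), G ∈ SPEX n (completeMinus H) ↔
          Nonempty (G ≃g book (r - 3) (n - r + 3))) := by
  obtain ⟨N, hN⟩ := exists_dominating_of_mem_SPEX (γ := r - H.cliqueNum - 1) H (by omega) (by omega)
  -- Having n ≥ r makes the truncated `n - r + 3` equal to `n - (r - 3)`.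
  refine ⟨max N r, fun n hn => ?_⟩
  have hnN : N ≤ n := (le_max_left _ _).trans hn
  have hnr : r ≤ n := (le_max_right _ _).trans hn
  refine ⟨fun G hG => ?_, fun hω hH => ?_, fun hω hH => ?_⟩
  · obtain ⟨L, hL, hdom⟩ := hN n hnN G hG
    exact containsSpanning_book hL (by omega) hdom
  · refine mem_SPEX_iff_of_unique (not_isMinor_bookWithEdges hH (by omega)) fun G hG => ?_
    obtain ⟨L, hL, hdom⟩ := hN n hnN G hG
    have hL3 : L.card = r - 3 := by omega
    obtain ⟨l, hl⟩ := Finset.card_pos.1 (by omega : 0 < L.card)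
    obtain ⟨s, hs⟩ := H.exists_isNClique_cliqueNum
    rw [hω] at hs
    obtain ⟨a, b, hab, rfl⟩ := Finset.card_eq_two.1 hs.card_eq
    have hHab : H.Adj a b := hs.isClique (by simp) (by simp) hab
    obtain ⟨c, hc⟩ : ∃ c, c ∉ ({a, b} : Finset (Fin r)) := by
      by_contra hcon
      push Not at hcon
      have := Finset.card_le_card fun (i : Fin r) (_ : i ∈ Finset.univ) => hcon i
      rw [Finset.card_univ, Fintype.card_fin, hs.card_eq] at this
      omega
    simp only [Finset.mem_insert, Finset.mem_singleton, not_or] at hc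
    -- If u had two neighbours v, w outside L, the edge `a b` of `H` would be placed on v, w, where
    -- no adjacency is needed, and c on u.
    obtain ⟨e, he⟩ := exists_equiv_isolatedEdges (t := n - r + 3) hL3 (by omega)
      fun u v w hu hv hw huv huw => by
        by_contra hvw
        exact hG.1 (isMinor_of_triple (by omega) hdom hab (Ne.symm hc.1) (Ne.symm hc.2) hv hw hu
          hvw huv.ne' huw.ne' (fun h => absurd hHab h) (fun _ => huv.symm) fun _ => huw.symm)
    exact nonempty_iso_of_mem_SPEX hG (hdom l hl) (not_isMinor_bookWithEdges hH (by omega))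
      (splitEquiv hL3 e) fun u v huv => join_adj_splitEquiv hL3 e he huv
  · refine mem_SPEX_iff_of_unique (not_isMinor_book (by omega)) fun G hG => ?_
    obtain ⟨L, hL, hdom⟩ := hN n hnN G hG
    have hL3 : L.card = r - 3 := by omega
    obtain ⟨l, hl⟩ := Finset.card_pos.1 (by omega : 0 < L.card)
    simp only [EdgesDisjoint, not_forall] at hH
    obtain ⟨a, b, c, hab, hac, hbc⟩ := hH
    obtain ⟨e⟩ := nonempty_equiv_compl (t := n - r + 3) hL3 (by omega)
    refine nonempty_iso_of_mem_SPEX hG (hdom l hl) (not_isMinor_book (by omega))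
      (splitEquiv hL3 e) fun u v huv => join_adj_splitEquiv hL3 e (fun v w hv hw hvw => ?_) huv
    -- With a adjacent to b and c in `H`, only the pair b, c may need an edge. So one edge `v w`
    -- outside L, plus any further vertex u in the role of a, gives the minor.
    obtain ⟨u, hu⟩ : ∃ u, u ∉ insert v (insert w L) := by
      by_contra hcon
      push Not at hcon
      have h1 := Finset.card_le_card fun (i : Fin n) (_ : i ∈ Finset.univ) => hcon i
      have h2 := Finset.card_insert_le v (insert w L)
      have h3 := Finset.card_insert_le w L
      rw [Finset.card_univ, Fintype.card_fin] at h1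
      omega
    simp only [Finset.mem_insert, not_or] at hu
    exact absurd (isMinor_of_triple (by omega) hdom hab.ne hac.ne hbc hu.2.2 hv hw hu.1 hu.2.1
      hvw.ne (fun h => absurd hab h) (fun h => absurd hac h) fun _ => hvw) hG.1
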